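/- For $n\ge 0$ let $\psi_n(x)=\pi^{-1/4}(2^n n!)^{-1/2}e^{-x^2/2}H_n(x)$, $x\in\mathbb R$, be the normalized Hermite functions, where $H_n$ are the (physicists') Hermite polynomials, $H_n(x)=(-1)^n e^{x^2}\frac{d^n}{dx^n}e^{-x^2}$. For $a,y\in\mathbb C$ let $U(a,y)=D_{-a-1/2}(y)$ be the parabolic cylinder function, where $$D_\nu(y)=2^{\nu/2}\sqrt{\pi}\,e^{-y^2/4}\left(\frac{1}{\Gamma(\frac{1-\nu}{2})}\,M\!\left(-\tfrac{\nu}{2},\tfrac12;\tfrac{y^2}{2}\right)-\frac{\sqrt2\,y}{\Gamma(-\frac{\nu}{2})}\,M\!\left(\tfrac{1-\nu}{2},\tfrac32;\tfrac{y^2}{2}\right)\right)$$ and $M(a,b;w)=\sum_{n\ge0}\frac{(a)_n}{(b)_n}\frac{w^n}{n!}$ is Kummer's confluent hypergeometric function. Let $z\in\mathbb C$ with $\operatorname{Re} z>0$. Then the series $\sum_{n\ge0}\frac{\psi_n(x)^2}{n+z}$ converges absolutely and uniformly on $\mathbb R$ (both the series itself and the series of absolute values of its terms converge uniformly in $x\in\mathbb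 R$), and for every $x\in\mathbb R$ $$\Gamma(z)\,U\!\left(z-\tfrac12,\,x\sqrt2\right)U\!\left(z-\tfrac12,\,-x\sqrt2\right)=\sqrt{\pi}\,\sum_{n=0}^{\infty}\frac{\psi_n(x)^2}{n+z}.$$ -/

import Mathlib

noncomputable section

/-- Kummer's confluent hypergeometric function
`M(a, b; w) = ∑ₙ (a)ₙ / (b)ₙ * wⁿ / n!` (for `b ∉ {0, -1, -2, …}`), obtained from Mathlib's
regularized series `∑ₙ (a)ₙ / Γ(b + n) * wⁿ / n!` by multiplying with `Γ(b)`. -/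
def kummerM (a b w : ℂ) : ℂ :=
  Complex.Gamma b * Complex.regularizedHGFun {a} {b} w

/-- The (Whittaker) parabolic cylinder function `D_ν(y)`, an entire function of `ν` and `y`:
`2^(ν/2) √π e^(-y²/4) (M(-ν/2, 1/2; y²/2) / Γ((1-ν)/2) - √2 y M((1-ν)/2, 3/2; y²/2) / Γ(-ν/2))`.
At the poles of `Γ` the reciprocal `1 / Γ` is `0`, as it should be, by the conventions
`Γ(-m) = 0` and `1 / 0 = 0`. -/
def parabolicCylinderD (ν y : ℂ) : ℂ :=
  (2 : ℂ) ^ (ν / 2) * (Real.sqrt Real.pi : ℂ) * Complex.exp (-y ^ 2 / 4) *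
    (kummerM (-ν / 2) (1 / 2) (y ^ 2 / 2) / Complex.Gamma ((1 - ν) / 2) -
      (Real.sqrt 2 : ℂ) * y * kummerM ((1 - ν) / 2) (3 / 2) (y ^ 2 / 2) /
        Complex.Gamma (-ν / 2))

/-- The parabolic cylinder function `U(a, y) = D_{-a-1/2}(y)`. -/
def parabolicCylinderU (a y : ℂ) : ℂ :=
  parabolicCylinderD (-a - 1 / 2) y

/-- The physicists' Hermite polynomials `Hₙ(X) = (-1)ⁿ exp(X²) (d/dX)ⁿ exp(-X²)`, through the
recursion `H₀ = 1`, `Hₙ₊₁ = 2 X Hₙ - Hₙ'`. -/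
def hermiteH : ℕ → Polynomial ℝ
  | 0 => 1
  | n + 1 => 2 * Polynomial.X * hermiteH n - Polynomial.derivative (hermiteH n)

/-- The normalized Hermite functions `ψₙ(x) = π^(-1/4) (2ⁿ n!)^(-1/2) e^(-x²/2) Hₙ(x)`. -/
def hermitePsi (n : ℕ) (x : ℝ) : ℝ :=
  Real.pi ^ (-(1 / 4) : ℝ) * ((2 : ℝ) ^ n * (n.factorial : ℝ)) ^ (-(1 / 2) : ℝ) *
    Real.exp (-x ^ 2 / 2) * (hermiteH n).eval x

end

open MeasureTheory

/-! Both sides are reduced to the same integral over `w > 0`. On the series side, `1 / (n + z) = ∫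
(1 + w)^(-(n + z) - 1) dw`, and Mehler's formula on the diagonal (`hasSum_hermitePsi_sq`) at `r = 1
/ (1 + w)` sums the integrand in closed form: this is `tsum_hermitePsi_sq_div_eq_integral`. On the
cylinder side, `Γ(z) D_{-z}(y)` is `e^(-y²/4)` times the integral of `t^(z-1) e^(-t²/2 - yt)`
(`Gamma_mul_parabolicCylinderU`). In the product of the integrals at `c` and `-c`, the variables `p
= st` and `u = s - t` produce the factor `1 / √(u² + 4p)`. Writing it as a Laplace integral in `w`
and applying Fubini leaves a Gamma integral in `p` and a Gaussian in `u`
(`cylinderIntegral_mul_cylinderIntegral_neg_eq`). With `c = x√2` the two integrals agree. Uniform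
convergence comes from the same Mehler formula: half of the decay of `(1 + w)^(-n)` pays for summing
the squares, and the other half makes the tails small independently of `x`
(`sum_hermitePsi_sq_mul_le`). -/

/-! ### Hermite polynomials as Gaussian integrals. -/

theorem derivative_hermiteH_succ (n : ℕ) :
    Polynomial.derivative (hermiteH (n + 1)) = (2 * (n + 1) : ℝ) • hermiteH n := by
  induction n with
  | zero =>
    simp only [hermiteH, Polynomial.smul_eq_C_mul]
    simp [← map_ofNat (Polynomial.C : ℝ →+* _) 2]
  | succ n ih =>
    have h : hermiteH (n + 2) = 2 * Polynomial.X * hermiteH (n + 1)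
      - Polynomial.derivative (hermiteH (n + 1)) := rfl
    have h' : hermiteH (n + 1) = 2 * Polynomial.X * hermiteH n
      - Polynomial.derivative (hermiteH n) := rfl
    rw [h, map_sub, Polynomial.derivative_mul, ih, Polynomial.derivative_smul]
    simp only [Polynomial.smul_eq_C_mul, Polynomial.derivative_mul, Polynomial.derivative_X,
      Polynomial.derivative_ofNat, map_mul, map_add, map_one, map_ofNat, map_natCast,
      Nat.cast_add, Nat.cast_one]
    linear_combination (2 * (n : Polynomial ℝ) + 2) * (-h')

theorem eval_hermiteH_add_two (n : ℕ) (x : ℝ) :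
    (hermiteH (n + 2)).eval x =
      2 * x * (hermiteH (n + 1)).eval x - 2 * (n + 1) * (hermiteH n).eval x := by
  have h : hermiteH (n + 2) = 2 * Polynomial.X * hermiteH (n + 1)
      - Polynomial.derivative (hermiteH (n + 1)) := rfl
  rw [h, derivative_hermiteH_succ]
  simp

theorem integrable_pow_mul_gaussian (n : ℕ) (x : ℝ) :
    Integrable (fun y : ℝ => (2 * (x + Complex.I * y)) ^ n * Complex.exp (-(y : ℂ) ^ 2)) := by
  -- The constant `2` absorbs the linear term: `2|y| - y² ≤ 2 - y²/2`, that is, `(|y| - 2)² ≥ 0`.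
  have hb : Integrable (fun y : ℝ => (n.factorial * Real.exp (2 * |x| + 2)) *
      Real.exp (-(1 / 2) * y ^ 2)) := (integrable_exp_neg_mul_sq (by norm_num)).const_mul _
  refine hb.mono' (by fun_prop) (Filter.Eventually.of_forall fun y => ?_)
  have h1 : ‖(2 * (x + Complex.I * y) : ℂ)‖ ≤ 2 * |x| + 2 * |y| := by
    rw [norm_mul]
    have := norm_add_le (x : ℂ) (Complex.I * y)
    simp only [norm_mul, Complex.norm_I, Complex.norm_real, Real.norm_eq_abs, one_mul] at this
    simp only [Complex.norm_ofNat]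
    linarith
  have h2 : (2 * |x| + 2 * |y|) ^ n ≤ n.factorial * Real.exp (2 * |x| + 2 * |y|) := by
    have := Real.pow_div_factorial_le_exp (2 * |x| + 2 * |y|) (by positivity) n
    rwa [div_le_iff₀' (by positivity)] at this
  rw [norm_mul, norm_pow, Complex.norm_exp]
  have h3 : (-(y : ℂ) ^ 2).re = -y ^ 2 := by norm_cast
  rw [h3]
  calc _ ≤ (2 * |x| + 2 * |y|) ^ n * Real.exp (-y ^ 2) := by gcongr
    _ ≤ n.factorial * Real.exp (2 * |x| + 2 * |y|) * Real.exp (-y ^ 2) := by gcongr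
    _ ≤ _ := by
      rw [mul_assoc, mul_assoc, ← Real.exp_add, ← Real.exp_add]
      refine mul_le_mul_of_nonneg_left (Real.exp_le_exp.2 ?_) (by positivity)
      nlinarith [sq_nonneg (|y| - 2), sq_abs y]

/-- The integral of the derivative of `(2(x + iy))^n e^(-y²)` vanishes. Since `-2y = i(2(x + iy) -
2x)`, this is `i` times the three-term Hermite recurrence for the integrals. The exponent `n - 1`
truncates at `n = 0`, where its coefficient `n` is zero. -/
theorem integral_pow_mul_gaussian (n : ℕ) (x : ℝ) :
    ∫ y : ℝ, (2 * (x + Complex.I * y)) ^ n * Complex.exp (-(y : ℂ) ^ 2) =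
      (Real.sqrt Real.pi : ℂ) * ((hermiteH n).eval x : ℝ) := by
  have h0 : ∫ y : ℝ, Complex.exp (-(y : ℂ) ^ 2) = (Real.sqrt Real.pi : ℂ) := by
    have := integral_gaussian 1
    rw [div_one] at this
    rw [← this, ← integral_complex_ofReal]
    congr with y
    push_cast
    ring_nf
  have hrec (n : ℕ) : ∫ y : ℝ, (((n : ℂ) * 2 * (2 * (x + Complex.I * y)) ^ (n - 1)) *
        Complex.exp (-(y : ℂ) ^ 2) +
        ((2 * (x + Complex.I * y)) ^ (n + 1) * Complex.exp (-(y : ℂ) ^ 2)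
        - 2 * x * ((2 * (x + Complex.I * y)) ^ n * Complex.exp (-(y : ℂ) ^ 2)))) = 0 := by
    have key : ∫ y : ℝ, Complex.I * (((n : ℂ) * 2 * (2 * (x + Complex.I * y)) ^ (n - 1)) *
        Complex.exp (-(y : ℂ) ^ 2) +
        ((2 * (x + Complex.I * y)) ^ (n + 1) * Complex.exp (-(y : ℂ) ^ 2)
        - 2 * x * ((2 * (x + Complex.I * y)) ^ n * Complex.exp (-(y : ℂ) ^ 2)))) = 0 := by
      refine integral_eq_zero_of_hasDerivAt_of_integrable (f := fun y : ℝ =>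
        (2 * (x + Complex.I * y)) ^ n * Complex.exp (-(y : ℂ) ^ 2)) (fun y => ?_) ?_
        (integrable_pow_mul_gaussian n x)
      · have hy : HasDerivAt (fun y : ℝ => (y : ℂ)) 1 y := Complex.ofRealCLM.hasDerivAt
        have h1 : HasDerivAt (fun y : ℝ => (2 * (x + Complex.I * y) : ℂ)) (2 * Complex.I) y := by
          simpa using ((hy.const_mul Complex.I).const_add (x : ℂ)).const_mul 2
        refine ((h1.pow n).mul (hy.pow 2).neg.cexp).congr_deriv ?_
        simp only [Pi.pow_apply, Pi.neg_apply]
        push_cast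
        linear_combination -2 * y * (2 * (x + Complex.I * y)) ^ n * Complex.exp (-(y : ℂ) ^ 2) *
          Complex.I_sq
      · refine Integrable.const_mul (.add ?_ (.sub ?_ ?_)) _
        · simp_rw [mul_assoc ((n : ℂ) * 2)]
          exact (integrable_pow_mul_gaussian _ x).const_mul _
        · exact integrable_pow_mul_gaussian _ x
        · exact (integrable_pow_mul_gaussian _ x).const_mul _
    rw [integral_const_mul] at key
    simpa [Complex.I_ne_zero] using key
  have hrec' (n : ℕ) := hrec n
  simp_rw [mul_assoc ((_ : ℂ) * 2)] at hrec'
  have hrec'' (n : ℕ) : (n : ℂ) * 2 * (∫ y : ℝ, (2 * (x + Complex.I * y)) ^ (n - 1) *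
        Complex.exp (-(y : ℂ) ^ 2)) +
        ((∫ y : ℝ, (2 * (x + Complex.I * y)) ^ (n + 1) * Complex.exp (-(y : ℂ) ^ 2))
        - 2 * x * ∫ y : ℝ, (2 * (x + Complex.I * y)) ^ n * Complex.exp (-(y : ℂ) ^ 2)) = 0 := by
    rw [← hrec' n, integral_add, integral_sub, integral_const_mul, integral_const_mul]
    · exact integrable_pow_mul_gaussian _ x
    · exact (integrable_pow_mul_gaussian _ x).const_mul _
    · exact (integrable_pow_mul_gaussian _ x).const_mul _
    · exact (integrable_pow_mul_gaussian _ x).sub ((integrable_pow_mul_gaussian _ x).const_mul _)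
  induction n using Nat.twoStepInduction with
  | zero => simpa [hermiteH] using h0
  | one =>
    have := hrec'' 0
    simp only [pow_zero, one_mul, h0] at this
    simp only [hermiteH]
    simp at this ⊢
    linear_combination this
  | more n ih1 ih2 =>
    have := hrec'' (n + 1)
    simp only [Nat.add_sub_cancel] at this
    rw [ih1, ih2] at this
    rw [eval_hermiteH_add_two]
    push_cast at this ⊢
    linear_combination this

/-! ### Mehler's formula on the diagonal. -/

/-- Two successive Gaussian integrals: after the one in `y'`, the coefficient of `y²` is `r² - 1`,
which is negative. -/
theorem integral_integral_mehler {r : ℝ} (hr0 : 0 ≤ r) (hr1 : r < 1) (x : ℝ) :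
    ∫ y : ℝ, ∫ y' : ℝ, Complex.exp (2 * r * ((x + Complex.I * y) * (x + Complex.I * y'))
        + (-(y : ℂ) ^ 2 + -(y' : ℂ) ^ 2)) =
      ((Real.pi / Real.sqrt (1 - r ^ 2) * Real.exp (2 * r * x ^ 2 / (1 + r)) : ℝ) : ℂ) := by
  have h1 (y : ℝ) : ∫ y' : ℝ, Complex.exp (2 * r * ((x + Complex.I * y) * (x + Complex.I * y'))
        + (-(y : ℂ) ^ 2 + -(y' : ℂ) ^ 2)) = (Real.pi : ℂ) ^ (1 / 2 : ℂ) *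
        Complex.exp (((r ^ 2 - 1 : ℝ) : ℂ) * y ^ 2 + (2 * Complex.I * x * r * (1 - r)) * y +
          x ^ 2 * (2 * r - r ^ 2)) := by
    have := integral_cexp_quadratic (b := -1) (by simp) (2 * r * (x + Complex.I * y) * Complex.I)
      (2 * r * x * (x + Complex.I * y) - y ^ 2)
    simp only [neg_neg, div_one] at this
    convert this using 2
    · ext y'; congr 1; ring
    · congr 1
      push_cast
      linear_combination -(2 * r * y * x * r * Complex.I + r ^ 2 * y ^ 2 * Complex.I ^ 2 - r ^ 2 * y ^ 2 + r ^ 2 * x ^ 2) * Complex.I_sq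
  have hr2 : 0 < 1 - r ^ 2 := by nlinarith
  simp_rw [h1]
  rw [integral_const_mul, integral_cexp_quadratic (by rw [Complex.ofReal_re]; linarith), ← mul_assoc]
  have h2 : ((Real.pi : ℂ) / -((r ^ 2 - 1 : ℝ) : ℂ)) = ((Real.pi / (1 - r ^ 2) : ℝ) : ℂ) := by
    push_cast; ring
  rw [h2]
  have h3 : (1 / 2 : ℂ) = ((1 / 2 : ℝ) : ℂ) := by norm_num
  rw [h3, ← Complex.ofReal_cpow Real.pi_nonneg, ← Complex.ofReal_cpow (by positivity),
    ← Real.sqrt_eq_rpow, ← Real.sqrt_eq_rpow, Real.sqrt_div Real.pi_nonneg]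
  push_cast
  congr 1
  · rw [← mul_div_assoc, ← Complex.ofReal_mul, Real.mul_self_sqrt Real.pi_nonneg]
  · congr 1
    have h4 : (1 + r : ℂ) ≠ 0 := by norm_cast; linarith
    have h5 : (1 - r : ℂ) ≠ 0 := by norm_cast; linarith
    have h6 : (r ^ 2 - 1 : ℂ) = - ((1 + r) * (1 - r)) := by ring
    rw [h6]
    have h7 : (2 * Complex.I * x * r * (1 - r)) ^ 2 = - (4 * x ^ 2 * r ^ 2 * (1 - r) ^ 2) := by
      linear_combination (4 * x ^ 2 * r ^ 2 * (1 - r) ^ 2 : ℂ) * Complex.I_sq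
    rw [h7]
    field_simp
    ring

theorem hasSum_pow_div_factorial_mul_exp (c d : ℝ) :
    HasSum (fun n : ℕ => c ^ n / (n.factorial : ℝ) * Real.exp d) (Real.exp (c + d)) := by
  rw [Real.exp_add, Real.exp_eq_exp_ℝ]
  exact (NormedSpace.expSeries_div_hasSum_exp c).mul_right _

theorem hasSum_pow_div_factorial_mul_cexp (c d : ℂ) :
    HasSum (fun n : ℕ => c ^ n / (n.factorial : ℂ) * Complex.exp d) (Complex.exp (c + d)) := by
  rw [Complex.exp_add, Complex.exp_eq_exp_ℂ]
  exact (NormedSpace.expSeries_div_hasSum_exp c).mul_right _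

/-- Each square of a Hermite value is a double Gaussian integral, and under the integral sign the
series is exponential. The exchange is dominated by the same series with norms, whose sum is
integrable because `2ab ≤ a² + b²` leaves the decay `e^(-(1-r)(y² + y'²))`. -/
theorem hasSum_hermiteH_sq {r : ℝ} (hr0 : 0 ≤ r) (hr1 : r < 1) (x : ℝ) :
    HasSum (fun n : ℕ => (r / 2) ^ n / n.factorial * (hermiteH n).eval x ^ 2)
      (Real.exp (2 * r * x ^ 2 / (1 + r)) / Real.sqrt (1 - r ^ 2)) := by
  have hn (y : ℝ) : ‖(x + Complex.I * y : ℂ)‖ ^ 2 = x ^ 2 + y ^ 2 := by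
    rw [Complex.sq_norm, Complex.normSq_apply]; simp; ring
  have hint : Integrable (fun p : ℝ × ℝ =>
      Real.exp (2 * r * (‖(x + Complex.I * p.1 : ℂ)‖ * ‖(x + Complex.I * p.2 : ℂ)‖)
        + (-p.1 ^ 2 + -p.2 ^ 2))) (volume.prod volume) := by
    have hg : Integrable (fun y : ℝ => Real.exp (-(1 - r) * y ^ 2)) :=
      integrable_exp_neg_mul_sq (by linarith)
    refine ((hg.mul_prod hg).const_mul (Real.exp (2 * r * x ^ 2))).mono' (by fun_prop)
      (Filter.Eventually.of_forall fun p => ?_)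
    rw [Real.norm_of_nonneg (by positivity), ← Real.exp_add, ← Real.exp_add]
    refine Real.exp_le_exp.2 ?_
    nlinarith [mul_nonneg hr0 (sq_nonneg
      (‖(x + Complex.I * p.1 : ℂ)‖ - ‖(x + Complex.I * p.2 : ℂ)‖)), hn p.1, hn p.2]
  have key : HasSum (fun n : ℕ => ∫ p : ℝ × ℝ, (2 * r * ((x + Complex.I * p.1) *
      (x + Complex.I * p.2))) ^ n / (n.factorial : ℂ) *
      Complex.exp (-(p.1 : ℂ) ^ 2 + -(p.2 : ℂ) ^ 2) ∂(volume.prod volume))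
      (∫ p : ℝ × ℝ, Complex.exp (2 * r * ((x + Complex.I * p.1) * (x + Complex.I * p.2))
        + (-(p.1 : ℂ) ^ 2 + -(p.2 : ℂ) ^ 2)) ∂(volume.prod volume)) := by
    have hs (p : ℝ × ℝ) : HasSum (fun n : ℕ =>
        (2 * r * (‖(x + Complex.I * p.1 : ℂ)‖ * ‖(x + Complex.I * p.2 : ℂ)‖)) ^ n /
        (n.factorial : ℝ) * Real.exp (-p.1 ^ 2 + -p.2 ^ 2))
        (Real.exp (2 * r * (‖(x + Complex.I * p.1 : ℂ)‖ * ‖(x + Complex.I * p.2 : ℂ)‖)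
        + (-p.1 ^ 2 + -p.2 ^ 2))) := hasSum_pow_div_factorial_mul_exp _ _
    refine hasSum_integral_of_dominated_convergence (fun n p =>
        (2 * r * (‖(x + Complex.I * p.1 : ℂ)‖ * ‖(x + Complex.I * p.2 : ℂ)‖)) ^ n /
        (n.factorial : ℝ) * Real.exp (-p.1 ^ 2 + -p.2 ^ 2)) (fun n => ?_)
        (fun n => Filter.Eventually.of_forall fun p => ?_)
        (Filter.Eventually.of_forall fun p => (hs p).summable) ?_
        (Filter.Eventually.of_forall fun p => ?_)
    · exact Continuous.aestronglyMeasurable (by fun_prop)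
    · rw [norm_mul, norm_div, norm_pow, Complex.norm_exp]
      have h3 : (-(p.1 : ℂ) ^ 2 + -(p.2 : ℂ) ^ 2).re = -p.1 ^ 2 + -p.2 ^ 2 := by norm_cast
      rw [h3]
      simp [abs_of_nonneg hr0]
    · simp_rw [fun p => (hs p).tsum_eq]
      exact hint
    · exact hasSum_pow_div_factorial_mul_cexp _ _
  have hI : Integrable (fun p : ℝ × ℝ => Complex.exp (2 * r * ((x + Complex.I * p.1) *
      (x + Complex.I * p.2)) + (-(p.1 : ℂ) ^ 2 + -(p.2 : ℂ) ^ 2))) (volume.prod volume) := by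
    refine hint.mono' (by fun_prop) (Filter.Eventually.of_forall fun p => ?_)
    rw [Complex.norm_exp]
    gcongr
    rw [Complex.add_re]
    refine add_le_add ?_ (by norm_cast)
    refine (Complex.re_le_norm _).trans ?_
    simp [abs_of_nonneg hr0]
  rw [integral_prod _ hI, integral_integral_mehler hr0 hr1] at key
  have hterm (n : ℕ) : ∫ p : ℝ × ℝ, (2 * r * ((x + Complex.I * p.1) *
      (x + Complex.I * p.2))) ^ n / (n.factorial : ℂ) *
      Complex.exp (-(p.1 : ℂ) ^ 2 + -(p.2 : ℂ) ^ 2) ∂(volume.prod volume) =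
      ((Real.pi * ((r / 2) ^ n / n.factorial * (hermiteH n).eval x ^ 2) : ℝ) : ℂ) := by
    have h := integral_prod_mul (μ := (volume : Measure ℝ)) (ν := (volume : Measure ℝ))
      (fun y : ℝ => (2 * (x + Complex.I * y)) ^ n * Complex.exp (-(y : ℂ) ^ 2))
      (fun y : ℝ => (2 * (x + Complex.I * y)) ^ n * Complex.exp (-(y : ℂ) ^ 2))
    have h' : (fun p : ℝ × ℝ => (2 * r * ((x + Complex.I * p.1) *
      (x + Complex.I * p.2))) ^ n / (n.factorial : ℂ) *
      Complex.exp (-(p.1 : ℂ) ^ 2 + -(p.2 : ℂ) ^ 2)) = fun p : ℝ × ℝ =>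
      ((r : ℂ) / 2) ^ n / n.factorial *
      (((2 * (x + Complex.I * p.1)) ^ n * Complex.exp (-(p.1 : ℂ) ^ 2)) *
      ((2 * (x + Complex.I * p.2)) ^ n * Complex.exp (-(p.2 : ℂ) ^ 2))) := by
      ext p
      have : (2 * r * ((x + Complex.I * p.1) * (x + Complex.I * p.2)) : ℂ) =
        r / 2 * (2 * (x + Complex.I * p.1)) * (2 * (x + Complex.I * p.2)) := by ring
      rw [Complex.exp_add, this, mul_pow, mul_pow]
      ring
    rw [h', integral_const_mul, h, integral_pow_mul_gaussian]
    have hpi : (Real.sqrt Real.pi : ℂ) * Real.sqrt Real.pi = Real.pi := by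
      rw [← Complex.ofReal_mul, Real.mul_self_sqrt Real.pi_nonneg]
    push_cast
    linear_combination ((r : ℂ) / 2) ^ n / n.factorial * (((hermiteH n).eval x : ℝ) : ℂ) ^ 2 * hpi
  simp_rw [hterm] at key
  have := (Complex.hasSum_ofReal.1 key).mul_left (Real.pi⁻¹)
  simp_rw [inv_mul_cancel_left₀ Real.pi_ne_zero] at this
  rwa [show Real.exp (2 * r * x ^ 2 / (1 + r)) / Real.sqrt (1 - r ^ 2) = Real.pi⁻¹ *
    (Real.pi / Real.sqrt (1 - r ^ 2) * Real.exp (2 * r * x ^ 2 / (1 + r))) by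
      field_simp]

theorem hermitePsi_sq (n : ℕ) (x : ℝ) :
    hermitePsi n x ^ 2 =
      Real.exp (-x ^ 2) / Real.sqrt Real.pi * ((1 / 2) ^ n / n.factorial *
        (hermiteH n).eval x ^ 2) := by
  have h1 : (Real.pi ^ (-(1 / 4) : ℝ)) ^ 2 = 1 / Real.sqrt Real.pi := by
    rw [← Real.rpow_natCast, ← Real.rpow_mul Real.pi_nonneg, Real.sqrt_eq_rpow,
      one_div (Real.pi ^ (1 / 2 : ℝ)), ← Real.rpow_neg Real.pi_nonneg]
    norm_num
  have h2 : (((2 : ℝ) ^ n * (n.factorial : ℝ)) ^ (-(1 / 2) : ℝ)) ^ 2 =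
      (1 / 2) ^ n / n.factorial := by
    rw [← Real.rpow_natCast, ← Real.rpow_mul (by positivity)]
    have : (-(1 / 2) * ((2 : ℕ) : ℝ)) = -1 := by norm_num
    rw [this, Real.rpow_neg_one, mul_inv, one_div, inv_pow, div_eq_mul_inv]
  have h3 : Real.exp (-x ^ 2 / 2) ^ 2 = Real.exp (-x ^ 2) := by
    rw [← Real.exp_nat_mul]
    congr 1
    push_cast
    ring
  rw [hermitePsi, mul_pow, mul_pow, mul_pow, h1, h2, h3]
  ring

/-- Mehler's formula on the diagonal. -/
theorem hasSum_hermitePsi_sq {r : ℝ} (hr0 : 0 ≤ r) (hr1 : r < 1) (x : ℝ) :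
    HasSum (fun n : ℕ => hermitePsi n x ^ 2 * r ^ n)
      (Real.exp (-x ^ 2 * ((1 - r) / (1 + r))) / Real.sqrt (Real.pi * (1 - r ^ 2))) := by
  have := (hasSum_hermiteH_sq hr0 hr1 x).mul_left (Real.exp (-x ^ 2) / Real.sqrt Real.pi)
  have hf : (fun n : ℕ => hermitePsi n x ^ 2 * r ^ n) = fun n : ℕ => Real.exp (-x ^ 2) /
      Real.sqrt Real.pi * ((r / 2) ^ n / n.factorial * (hermiteH n).eval x ^ 2) := by
    ext n
    rw [hermitePsi_sq, div_pow, div_pow]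
    ring
  have hv : Real.exp (-x ^ 2 * ((1 - r) / (1 + r))) / Real.sqrt (Real.pi * (1 - r ^ 2)) =
      Real.exp (-x ^ 2) / Real.sqrt Real.pi *
        (Real.exp (2 * r * x ^ 2 / (1 + r)) / Real.sqrt (1 - r ^ 2)) := by
    rw [div_mul_div_comm, ← Real.exp_add, Real.sqrt_mul Real.pi_nonneg]
    congr 2
    have : 1 + r ≠ 0 := by linarith
    field_simp
    ring
  rwa [hf, hv]

/-! ### Tail bounds uniform in `x`. -/

/-- This function serves as the majorant for the `w`-integrals, both in the tail estimates and in
the final Fubini argument. It behaves like `w^(-1/2)` at `0` and like `w^(-σ-1)` at infinity. -/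
theorem integrableOn_rpow_mul_one_add_rpow {σ : ℝ} (hσ : 0 < σ) :
    IntegrableOn (fun w : ℝ => w ^ (-(1 / 2) : ℝ) * (1 + w) ^ (-σ - 1 / 2)) (Set.Ioi 0) := by
  rw [← Set.Ioc_union_Ioi_eq_Ioi (zero_le_one' ℝ), integrableOn_union]
  constructor
  · have h : IntegrableOn (fun w : ℝ => w ^ (-(1 / 2) : ℝ)) (Set.Ioc 0 1) :=
      (intervalIntegrable_iff_integrableOn_Ioc_of_le zero_le_one).1
        (intervalIntegral.intervalIntegrable_rpow' (by norm_num))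
    refine h.mono' (Measurable.aestronglyMeasurable (by fun_prop)) ((ae_restrict_iff' measurableSet_Ioc).2
      (Filter.Eventually.of_forall fun w hw => ?_))
    have hw0 : 0 < w := hw.1
    rw [Real.norm_of_nonneg (by positivity)]
    exact mul_le_of_le_one_right (by positivity)
      (Real.rpow_le_one_of_one_le_of_nonpos (by linarith) (by linarith))
  · have h := integrableOn_Ioi_rpow_of_lt (a := -σ - 1) (by linarith) one_pos
    refine h.mono' (Measurable.aestronglyMeasurable (by fun_prop)) ((ae_restrict_iff' measurableSet_Ioi).2
      (Filter.Eventually.of_forall fun w hw => ?_))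
    have hw1 : 1 < w := hw
    have hw0 : 0 < w := by linarith
    rw [Real.norm_of_nonneg (by positivity),
      show -σ - 1 = -(1 / 2) + (-σ - 1 / 2) by ring, Real.rpow_add hw0]
    exact mul_le_mul_of_nonneg_left
      (Real.rpow_le_rpow_of_nonpos hw0 (by linarith) (by linarith)) (by positivity)

theorem one_add_rpow_neg_le {w : ℝ} (hw : 0 < w) (σ : ℝ) :
    (1 + w) ^ (-σ - 1) ≤ w ^ (-(1 / 2) : ℝ) * (1 + w) ^ (-σ - 1 / 2) := by
  rw [show -σ - 1 = -(1 / 2) + (-σ - 1 / 2) by ring, Real.rpow_add (by linarith)]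
  exact mul_le_mul_of_nonneg_right
    (Real.rpow_le_rpow_of_nonpos hw (by linarith) (by norm_num)) (by positivity)

theorem integrableOn_one_add_cpow {s : ℂ} (hs : 0 < s.re) :
    IntegrableOn (fun w : ℝ => ((1 + w : ℝ) : ℂ) ^ (-s - 1)) (Set.Ioi 0) := by
  refine (integrableOn_rpow_mul_one_add_rpow hs).mono' (Measurable.aestronglyMeasurable (by fun_prop))
    ((ae_restrict_iff' measurableSet_Ioi).2 (Filter.Eventually.of_forall fun w hw => ?_))
  have hw0 : 0 < w := hw
  rw [Complex.norm_cpow_eq_rpow_re_of_pos (by linarith)]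
  simpa using one_add_rpow_neg_le hw0 s.re

theorem integral_one_add_cpow {s : ℂ} (hs : 0 < s.re) :
    ∫ w in Set.Ioi (0 : ℝ), ((1 + w : ℝ) : ℂ) ^ (-s - 1) = 1 / s := by
  have h := (measurePreserving_add_left (volume : Measure ℝ) 1).setIntegral_preimage_emb
    (measurableEmbedding_addLeft (1 : ℝ)) (fun t : ℝ => (t : ℂ) ^ (-s - 1)) (Set.Ioi 1)
  have hp : (fun x : ℝ => 1 + x) ⁻¹' Set.Ioi 1 = Set.Ioi 0 := by ext; simp
  rw [hp, integral_Ioi_cpow_of_lt (by simp only [Complex.sub_re, Complex.neg_re, Complex.one_re]; linarith) one_pos] at h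
  rw [h]
  have : s ≠ 0 := fun h0 => by simp [h0] at hs
  simp [neg_div_neg_eq]

theorem integral_one_add_rpow {σ : ℝ} (hσ : 0 < σ) :
    ∫ w in Set.Ioi (0 : ℝ), (1 + w) ^ (-σ - 1) = 1 / σ := by
  have h := integral_one_add_cpow (s := (σ : ℂ)) (by simpa using hσ)
  have h' : ∫ w in Set.Ioi (0 : ℝ), ((1 + w : ℝ) : ℂ) ^ (-(σ : ℂ) - 1) =
      ∫ w in Set.Ioi (0 : ℝ), (((1 + w) ^ (-σ - 1) : ℝ) : ℂ) := by
    refine setIntegral_congr_fun measurableSet_Ioi fun w hw => ?_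
    have hw0 : (0 : ℝ) < w := hw
    rw [Complex.ofReal_cpow (by linarith)]
    push_cast
    rfl
  rw [h', integral_complex_ofReal] at h
  exact_mod_cast h

theorem integrableOn_one_add_rpow {σ : ℝ} (hσ : 0 < σ) :
    IntegrableOn (fun w : ℝ => (1 + w) ^ (-σ - 1)) (Set.Ioi 0) := by
  refine (integrableOn_rpow_mul_one_add_rpow hσ).mono' (Measurable.aestronglyMeasurable (by fun_prop))
    ((ae_restrict_iff' measurableSet_Ioi).2 (Filter.Eventually.of_forall fun w hw => ?_))
  have hw0 : (0 : ℝ) < w := hw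
  rw [Real.norm_of_nonneg (by positivity)]
  exact one_add_rpow_neg_le hw0 σ

/-- A bound, uniform in `x`, for the tail from `N` on of `∑ ψₙ(x)² / (n + σ)`. -/
noncomputable def hermiteTailBound (σ : ℝ) (N : ℕ) : ℝ :=
  ∫ w in Set.Ioi (0 : ℝ), (1 + w) ^ (-(N / 2) : ℝ) / Real.sqrt Real.pi *
    (w ^ (-(1 / 2) : ℝ) * (1 + w) ^ (-σ - 1 / 2))

theorem norm_hermiteTailBound_integrand_le {σ w : ℝ} (hw : 0 < w) (N : ℕ) :
    ‖(1 + w) ^ (-(N / 2) : ℝ) / Real.sqrt Real.pi *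
      (w ^ (-(1 / 2) : ℝ) * (1 + w) ^ (-σ - 1 / 2))‖ ≤
      w ^ (-(1 / 2) : ℝ) * (1 + w) ^ (-σ - 1 / 2) := by
  rw [Real.norm_of_nonneg (by positivity)]
  refine mul_le_of_le_one_left (by positivity) ((div_le_one (by positivity)).2 ?_)
  refine (Real.rpow_le_one_of_one_le_of_nonpos (by linarith) ?_).trans
    (Real.one_le_sqrt.2 (by linarith [Real.pi_gt_three]))
  have : (0 : ℝ) ≤ N := N.cast_nonneg
  linarith

theorem tendsto_hermiteTailBound {σ : ℝ} (hσ : 0 < σ) :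
    Filter.Tendsto (hermiteTailBound σ) Filter.atTop (nhds 0) := by
  have h := tendsto_integral_of_dominated_convergence
    (μ := (volume : Measure ℝ).restrict (Set.Ioi 0)) (f := fun _ => (0 : ℝ))
    (F := fun (N : ℕ) (w : ℝ) => (1 + w) ^ (-(N / 2) : ℝ) / Real.sqrt Real.pi *
    (w ^ (-(1 / 2) : ℝ) * (1 + w) ^ (-σ - 1 / 2))) _ (fun N => by fun_prop)
    (integrableOn_rpow_mul_one_add_rpow hσ)
    (fun N => (ae_restrict_iff' measurableSet_Ioi).2 (Filter.Eventually.of_forall fun w hw =>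
      norm_hermiteTailBound_integrand_le hw N))
    ((ae_restrict_iff' measurableSet_Ioi).2 (Filter.Eventually.of_forall fun w hw => ?_))
  · rw [integral_zero] at h
    exact h
  · have hw0 : (0 : ℝ) < w := hw
    have h1 : Filter.Tendsto (fun N : ℕ => (1 + w) ^ (-(N / 2) : ℝ)) Filter.atTop (nhds 0) := by
      have : ∀ N : ℕ, (1 + w) ^ (-(N / 2) : ℝ) = ((1 + w) ^ (-(1 / 2) : ℝ)) ^ N := fun N => by
        rw [← Real.rpow_natCast, ← Real.rpow_mul (by linarith)]
        congr 1
        ring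
      simp_rw [this]
      exact tendsto_pow_atTop_nhds_zero_of_lt_one (by positivity)
        (Real.rpow_lt_one_of_one_lt_of_neg (by linarith) (by norm_num))
    simpa using (h1.div_const (Real.sqrt Real.pi)).mul_const
      (w ^ (-(1 / 2) : ℝ) * (1 + w) ^ (-σ - 1 / 2))

/-- For `n ≥ N`, `(1 + w)^(-n) ≤ (1 + w)^(-N/2) ρ^n` with `ρ = (1 + w)^(-1/2)`. Mehler's formula at
`ρ` bounds the remaining sum; its exponential, the only place where `x` enters, is at most `1`. -/
theorem sum_hermitePsi_sq_mul_le {w : ℝ} (hw : 0 < w) (σ x : ℝ) (N M : ℕ) :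
    ∑ k ∈ Finset.range M, hermitePsi (k + N) x ^ 2 * (1 + w) ^ (-((k + N : ℕ) + σ) - 1) ≤
      (1 + w) ^ (-(N / 2) : ℝ) / Real.sqrt Real.pi *
        (w ^ (-(1 / 2) : ℝ) * (1 + w) ^ (-σ - 1 / 2)) := by
  have hw1 : 0 < 1 + w := by linarith
  set ρ : ℝ := (1 + w) ^ (-(1 / 2) : ℝ) with hρ
  have hρ0 : 0 < ρ := by positivity
  have hρ1 : ρ < 1 := Real.rpow_lt_one_of_one_lt_of_neg (by linarith) (by norm_num)
  have hρp (n : ℕ) : ρ ^ n = (1 + w) ^ (-(n / 2) : ℝ) := by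
    rw [hρ, ← Real.rpow_natCast, ← Real.rpow_mul hw1.le]
    congr 1
    ring
  have hm := hasSum_hermitePsi_sq hρ0.le hρ1 x
  have hbound : Real.exp (-x ^ 2 * ((1 - ρ) / (1 + ρ))) / Real.sqrt (Real.pi * (1 - ρ ^ 2)) ≤
      w ^ (-(1 / 2) : ℝ) * (1 + w) ^ (1 / 2 : ℝ) / Real.sqrt Real.pi := by
    have h1 : 1 - ρ ^ 2 = w / (1 + w) := by
      rw [hρp, show (-((2 : ℕ) / 2) : ℝ) = -1 by norm_num, Real.rpow_neg_one]
      field_simp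
      ring
    rw [h1, Real.sqrt_mul Real.pi_nonneg, Real.sqrt_div hw.le, Real.rpow_neg hw.le,
      ← Real.sqrt_eq_rpow, ← Real.sqrt_eq_rpow]
    have h2 : Real.exp (-x ^ 2 * ((1 - ρ) / (1 + ρ))) ≤ 1 := by
      rw [Real.exp_le_one_iff, neg_mul, neg_nonpos]
      have : 0 < 1 - ρ := by linarith
      positivity
    calc _ ≤ 1 / (Real.sqrt Real.pi * (Real.sqrt w / Real.sqrt (1 + w))) := by gcongr
      _ = _ := by
        have : Real.sqrt (1 + w) ≠ 0 := by positivity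
        field_simp
  calc _ ≤ ∑ k ∈ Finset.range M, (1 + w) ^ (-(N / 2) - σ - 1 : ℝ) *
        (hermitePsi (k + N) x ^ 2 * ρ ^ (k + N)) := by
        refine Finset.sum_le_sum fun k _ => ?_
        rw [mul_left_comm]
        refine mul_le_mul_of_nonneg_left ?_ (sq_nonneg _)
        rw [hρp, ← Real.rpow_add hw1]
        refine Real.rpow_le_rpow_of_exponent_le (by linarith) ?_
        push_cast
        have : (0 : ℝ) ≤ k := k.cast_nonneg
        linarith
    _ = (1 + w) ^ (-(N / 2) - σ - 1 : ℝ) * ∑ k ∈ Finset.range M,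
        (hermitePsi (k + N) x ^ 2 * ρ ^ (k + N)) := by rw [Finset.mul_sum]
    _ ≤ (1 + w) ^ (-(N / 2) - σ - 1 : ℝ) *
        (w ^ (-(1 / 2) : ℝ) * (1 + w) ^ (1 / 2 : ℝ) / Real.sqrt Real.pi) := by
        refine mul_le_mul_of_nonneg_left (le_trans ?_ hbound) (by positivity)
        have := sum_le_hasSum ((Finset.range M).map (addRightEmbedding N))
          (fun n _ => by positivity) hm
        simpa using this
    _ = _ := by
      rw [show (-(N / 2) - σ - 1 : ℝ) = -(N / 2) + ((-σ - 1 / 2) + -(1 / 2)) by ring,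
        Real.rpow_add hw1, Real.rpow_add hw1, Real.rpow_neg hw1.le (1 / 2)]
      have : (1 + w) ^ (1 / 2 : ℝ) ≠ 0 := by positivity
      field_simp

theorem sum_hermitePsi_sq_div_le {σ : ℝ} (hσ : 0 < σ) (x : ℝ) (N M : ℕ) :
    ∑ k ∈ Finset.range M, hermitePsi (k + N) x ^ 2 / ((k + N : ℕ) + σ) ≤
      hermiteTailBound σ N := by
  have hpos (n : ℕ) : 0 < (n : ℝ) + σ := by positivity
  have hi (n : ℕ) : IntegrableOn (fun w : ℝ => hermitePsi n x ^ 2 * (1 + w) ^ (-(n + σ) - 1))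
      (Set.Ioi 0) := (integrableOn_one_add_rpow (hpos n)).const_mul _
  calc _ = ∑ k ∈ Finset.range M, ∫ w in Set.Ioi (0 : ℝ),
        hermitePsi (k + N) x ^ 2 * (1 + w) ^ (-((k + N : ℕ) + σ) - 1) := by
        refine Finset.sum_congr rfl fun k _ => ?_
        rw [integral_const_mul, integral_one_add_rpow (hpos _), mul_one_div]
    _ = ∫ w in Set.Ioi (0 : ℝ), ∑ k ∈ Finset.range M,
        hermitePsi (k + N) x ^ 2 * (1 + w) ^ (-((k + N : ℕ) + σ) - 1) :=
        (integral_finsetSum _ fun k _ => hi (k + N)).symm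
    _ ≤ _ := by
      refine setIntegral_mono_on (integrable_finsetSum _ fun k _ => hi (k + N)) ?_
        measurableSet_Ioi fun w hw => sum_hermitePsi_sq_mul_le hw σ x N M
      exact (integrableOn_rpow_mul_one_add_rpow hσ).mono' (Measurable.aestronglyMeasurable (by fun_prop))
        ((ae_restrict_iff' measurableSet_Ioi).2 (Filter.Eventually.of_forall fun w hw =>
          norm_hermiteTailBound_integrand_le hw N))

theorem norm_hermitePsi_sq_div_le {z : ℂ} (hz : 0 < z.re) (n : ℕ) (x : ℝ) :
    ‖((hermitePsi n x : ℝ) : ℂ) ^ 2 / ((n : ℂ) + z)‖ ≤ hermitePsi n x ^ 2 / (n + z.re) := by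
  rw [norm_div, norm_pow, Complex.norm_real, Real.norm_eq_abs, sq_abs]
  have h : (n : ℝ) + z.re ≤ ‖(n : ℂ) + z‖ := by
    simpa using Complex.re_le_norm ((n : ℂ) + z)
  have : (0 : ℝ) < n + z.re := by positivity
  gcongr

theorem sum_norm_hermitePsi_sq_div_le {z : ℂ} (hz : 0 < z.re) (N M : ℕ) (x : ℝ) :
    ∑ k ∈ Finset.range M, ‖((hermitePsi (k + N) x : ℝ) : ℂ) ^ 2 / (((k + N : ℕ) : ℂ) + z)‖ ≤
      hermiteTailBound z.re N :=
  (Finset.sum_le_sum fun k _ => norm_hermitePsi_sq_div_le hz (k + N) x).trans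
    (sum_hermitePsi_sq_div_le hz x N M)

theorem summable_norm_of_tail_le {E : Type*} [NormedAddCommGroup E] {f : ℕ → E} {g : ℕ → ℝ}
    (h : ∀ N M, ∑ k ∈ Finset.range M, ‖f (k + N)‖ ≤ g N) : Summable (fun n => ‖f n‖) :=
  summable_of_sum_range_le (fun _ => norm_nonneg _) (by simpa using h 0)

/-- A bound on whole tails replaces the Weierstrass M-test, so no pointwise estimate of individual
Hermite functions is needed. -/
theorem tendstoUniformly_sum_of_tail_le {X E : Type*} [NormedAddCommGroup E] [CompleteSpace E]
    {f : ℕ → X → E} {g : ℕ → ℝ} (hg : Filter.Tendsto g Filter.atTop (nhds 0))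
    (h : ∀ N M x, ∑ k ∈ Finset.range M, ‖f (k + N) x‖ ≤ g N) :
    TendstoUniformly (fun (N : ℕ) x => ∑ n ∈ Finset.range N, f n x) (fun x => ∑' n, f n x)
      Filter.atTop := by
  rw [Metric.tendstoUniformly_iff]
  intro ε hε
  filter_upwards [hg.eventually (gt_mem_nhds hε)] with N hN x
  have hs : Summable (fun n => ‖f n x‖) := summable_norm_of_tail_le fun N M => h N M x
  rw [dist_eq_norm, ← hs.of_norm.sum_add_tsum_nat_add N, add_sub_cancel_left]
  have hs' : Summable (fun n => ‖f (n + N) x‖) := (summable_nat_add_iff N).2 hs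
  exact ((norm_tsum_le_tsum_norm hs').trans
    (Real.tsum_le_of_sum_range_le (fun _ => norm_nonneg _) fun M => h N M x)).trans_lt hN

/-! ### Integral representation of the parabolic cylinder function. -/

theorem kummerM_eq_tsum (a w : ℂ) {b : ℂ} (hb : 0 < b.re) :
    kummerM a b w = ∑' n : ℕ, (ascPochhammer ℂ n).eval a /
      (n.factorial * (ascPochhammer ℂ n).eval b) * w ^ n := by
  have hb' (k : ℕ) : b ≠ -k := fun h => by
    have hk : (0 : ℝ) ≤ k := k.cast_nonneg
    rw [h] at hb
    simp at hb
    linarith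
  have hG : Complex.Gamma b ≠ 0 := Complex.Gamma_ne_zero_of_re_pos hb
  have hs : Complex.regularizedHGFun {a} {b} w =
      ∑' n : ℕ, Complex.regularizedHGFunCoeff {a} {b} n • w ^ n :=
    FormalMultilinearSeries.ofScalars_sum_eq _ w
  rw [kummerM, hs, ← tsum_mul_left]
  congr 1
  ext n
  have hGn : Complex.Gamma (b + n) ≠ 0 :=
    Complex.Gamma_ne_zero_of_re_pos (by simp only [Complex.add_re, Complex.natCast_re]; positivity)
  have hn : (n.factorial : ℂ) ≠ 0 := by exact_mod_cast n.factorial_ne_zero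
  rw [← Complex.Gamma_add_nat_div_Gamma_eq b hb']
  simp only [Complex.regularizedHGFunCoeff, Multiset.map_singleton, Multiset.prod_singleton,
    smul_eq_mul]
  field_simp

theorem ascPochhammer_one_half (m : ℕ) :
    (m.factorial : ℂ) * (ascPochhammer ℂ m).eval (1 / 2) * 4 ^ m = ((2 * m).factorial : ℂ) := by
  induction m with
  | zero => simp
  | succ m ih =>
    rw [show 2 * (m + 1) = 2 * m + 1 + 1 by ring, Nat.factorial_succ, Nat.factorial_succ,
      Nat.factorial_succ, ascPochhammer_succ_eval]
    push_cast
    rw [← ih]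
    ring

theorem ascPochhammer_three_halves (m : ℕ) :
    (m.factorial : ℂ) * (ascPochhammer ℂ m).eval (3 / 2) * 4 ^ m =
      ((2 * m + 1).factorial : ℂ) := by
  induction m with
  | zero => simp
  | succ m ih =>
    rw [show 2 * (m + 1) + 1 = 2 * m + 1 + 1 + 1 by ring, Nat.factorial_succ (2 * m + 1 + 1),
      Nat.factorial_succ (2 * m + 1), Nat.factorial_succ, ascPochhammer_succ_eval]
    push_cast
    rw [← ih]
    ring

theorem Gamma_add_nat_eq_ascPochhammer {s : ℂ} (hs : 0 < s.re) (m : ℕ) :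
    Complex.Gamma (s + m) = (ascPochhammer ℂ m).eval s * Complex.Gamma s := by
  have hs' (k : ℕ) : s ≠ -k := fun h => by
    have hk : (0 : ℝ) ≤ k := k.cast_nonneg
    rw [h] at hs
    simp at hs
    linarith
  rw [← Complex.Gamma_add_nat_div_Gamma_eq s hs',
    div_mul_cancel₀ _ (Complex.Gamma_ne_zero_of_re_pos hs)]

theorem integral_cpow_mul_exp_neg_sq_div_two {s : ℂ} (hs : 0 < s.re) :
    ∫ t in Set.Ioi (0 : ℝ), (t : ℂ) ^ (s - 1) * Complex.exp (-(t : ℂ) ^ 2 / 2) =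
      2 ^ (s / 2 - 1) * Complex.Gamma (s / 2) := by
  have hs2 : 0 < (s / 2).re := by simpa using hs
  have h1 := Complex.integral_cpow_mul_exp_neg_mul_Ioi (r := 1 / 2) hs2 (by norm_num)
  rw [← integral_comp_rpow_Ioi_of_pos (p := 2) two_pos] at h1
  have h2 : ∫ t in Set.Ioi (0 : ℝ), ((2 : ℝ) * t ^ ((2 : ℝ) - 1)) •
      (((t ^ (2 : ℝ) : ℝ) : ℂ) ^ (s / 2 - 1) *
        Complex.exp (-(((1 / 2 : ℝ) : ℂ) * ((t ^ (2 : ℝ) : ℝ) : ℂ)))) =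
      ∫ t in Set.Ioi (0 : ℝ), 2 * ((t : ℂ) ^ (s - 1) * Complex.exp (-(t : ℂ) ^ 2 / 2)) := by
    refine setIntegral_congr_fun measurableSet_Ioi fun t ht => ?_
    have ht0 : (0 : ℝ) < t := ht
    have htc : (t : ℂ) ≠ 0 := by exact_mod_cast ht0.ne'
    have e1 : ((t ^ (2 : ℝ) : ℝ) : ℂ) ^ (s / 2 - 1) = (t : ℂ) ^ (s - 2) := by
      rw [← Nat.cast_ofNat (R := ℝ), Real.rpow_natCast, Complex.ofReal_pow, sq, Complex.mul_cpow_ofReal_nonneg ht0.le ht0.le, ← Complex.cpow_add _ _ htc]; ring_nf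
    have e2 : (t : ℂ) ^ (s - 1) = t * (t : ℂ) ^ (s - 2) := by
      rw [show s - 1 = 1 + (s - 2) by ring, Complex.cpow_add _ _ htc, Complex.cpow_one]
    simp only [e1, e2, Complex.real_smul]
    norm_num
    ring_nf
  rw [h2, integral_const_mul] at h1
  have h3 : (2 : ℂ) ^ (s / 2 - 1) = (1 / ((1 / 2 : ℝ) : ℂ)) ^ (s / 2) / 2 := by
    rw [Complex.cpow_sub _ _ two_ne_zero, Complex.cpow_one]
    norm_num
  rw [h3]
  linear_combination h1 / 2

/-- The integral representing `Γ(z) e^(y²/4) D_{-z}(y)`. -/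
noncomputable def cylinderIntegral (z : ℂ) (y : ℝ) : ℂ :=
  ∫ t in Set.Ioi (0 : ℝ), (t : ℂ) ^ (z - 1) * Complex.exp (-(t : ℂ) ^ 2 / 2 - y * t)

theorem integrableOn_rpow_mul_exp_neg_sq_div_two_add {σ : ℝ} (hσ : 0 < σ) (c : ℝ) :
    IntegrableOn (fun t : ℝ => t ^ (σ - 1) * Real.exp (-t ^ 2 / 2 + c * t)) (Set.Ioi 0) := by
  -- Half of the Gaussian pays for the linear term: `ct ≤ t²/4 + c²`.
  have h := ((integrableOn_rpow_mul_exp_neg_mul_sq (b := 1 / 4) (by norm_num)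
    (s := σ - 1) (by linarith)).const_mul (Real.exp (c ^ 2)))
  refine h.mono' (Measurable.aestronglyMeasurable (by fun_prop))
    ((ae_restrict_iff' measurableSet_Ioi).2 (Filter.Eventually.of_forall fun t ht => ?_))
  have ht0 : (0 : ℝ) < t := ht
  rw [Real.norm_of_nonneg (by positivity), mul_left_comm, ← Real.exp_add]
  refine mul_le_mul_of_nonneg_left (Real.exp_le_exp.2 ?_) (by positivity)
  nlinarith [sq_nonneg (t / 2 - c)]

theorem integrableOn_cylinderIntegrand {z : ℂ} (hz : 0 < z.re) (y : ℝ) :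
    IntegrableOn (fun t : ℝ => (t : ℂ) ^ (z - 1) * Complex.exp (-(t : ℂ) ^ 2 / 2 - y * t))
      (Set.Ioi 0) := by
  refine (integrableOn_rpow_mul_exp_neg_sq_div_two_add hz (-y)).mono'
    (Measurable.aestronglyMeasurable (by fun_prop))
    ((ae_restrict_iff' measurableSet_Ioi).2 (Filter.Eventually.of_forall fun t ht => ?_))
  have ht0 : (0 : ℝ) < t := ht
  rw [norm_mul, Complex.norm_cpow_eq_rpow_re_of_pos ht0, Complex.norm_exp,
    show (-(t : ℂ) ^ 2 / 2 - y * t) = ((-t ^ 2 / 2 + -y * t : ℝ) : ℂ) by push_cast; ring,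
    Complex.ofReal_re]
  simp

/-- Expand `e^(-yt)` and integrate termwise, dominated by the series of `e^(|y|t)`. The even and odd
terms of this series become the two Kummer functions. -/
theorem hasSum_cylinderIntegral {z : ℂ} (hz : 0 < z.re) (y : ℝ) :
    HasSum (fun k : ℕ => (-y : ℂ) ^ k / k.factorial *
      (2 ^ ((z + k) / 2 - 1) * Complex.Gamma ((z + k) / 2))) (cylinderIntegral z y) := by
  have hs (t : ℝ) : HasSum (fun k : ℕ => (|y| * t) ^ k / (k.factorial : ℝ) *
      Real.exp (-t ^ 2 / 2)) (Real.exp (-t ^ 2 / 2 + |y| * t)) := by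
    rw [add_comm]
    exact hasSum_pow_div_factorial_mul_exp _ _
  have key : HasSum (fun k : ℕ => ∫ t in Set.Ioi (0 : ℝ), (t : ℂ) ^ (z - 1) *
      ((-y * t : ℂ) ^ k / k.factorial * Complex.exp (-(t : ℂ) ^ 2 / 2))) (cylinderIntegral z y) := by
    refine hasSum_integral_of_dominated_convergence (fun (k : ℕ) (t : ℝ) => t ^ (z.re - 1) *
      ((|y| * t) ^ k / (k.factorial : ℝ) * Real.exp (-t ^ 2 / 2)))
      (fun k => Measurable.aestronglyMeasurable (by fun_prop))
      (fun k => (ae_restrict_iff' measurableSet_Ioi).2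
        (Filter.Eventually.of_forall fun t ht => ?_))
      (Filter.Eventually.of_forall fun t => (hs t).summable.mul_left _) ?_
      (Filter.Eventually.of_forall fun t => HasSum.mul_left _ ?_)
    · have ht0 : (0 : ℝ) < t := ht
      rw [norm_mul, Complex.norm_cpow_eq_rpow_re_of_pos ht0, norm_mul, Complex.norm_exp,
        show (-(t : ℂ) ^ 2 / 2) = ((-t ^ 2 / 2 : ℝ) : ℂ) by push_cast; ring, Complex.ofReal_re]
      simp [abs_of_pos ht0]
    · simp_rw [tsum_mul_left, fun t => (hs t).tsum_eq]
      exact integrableOn_rpow_mul_exp_neg_sq_div_two_add hz |y|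
    · have := hasSum_pow_div_factorial_mul_cexp (-y * t) (-(t : ℂ) ^ 2 / 2)
      rwa [show (-(t : ℂ) ^ 2 / 2 - y * t) = -y * t + -(t : ℂ) ^ 2 / 2 by ring]
  convert key using 2 with k
  have hk : 0 < (z + k).re := by
    simp only [Complex.add_re, Complex.natCast_re]
    positivity
  rw [← integral_cpow_mul_exp_neg_sq_div_two hk, ← integral_const_mul]
  refine setIntegral_congr_fun measurableSet_Ioi fun t ht => ?_
  have htc : (t : ℂ) ≠ 0 := by exact_mod_cast (ne_of_gt ht : t ≠ 0)
  rw [show z + k - 1 = (z - 1) + k by ring, Complex.cpow_add _ _ htc, Complex.cpow_natCast,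
    mul_pow]
  ring

theorem cylinderIntegral_even_term {z : ℂ} (hz : 0 < z.re) (y : ℂ) (m : ℕ) :
    (-y) ^ (2 * m) / (2 * m).factorial * (2 ^ ((z + ((2 * m : ℕ) : ℂ)) / 2 - 1) *
      Complex.Gamma ((z + ((2 * m : ℕ) : ℂ)) / 2)) =
    2 ^ (z / 2 - 1) * Complex.Gamma (z / 2) * ((ascPochhammer ℂ m).eval (z / 2) /
      (m.factorial * (ascPochhammer ℂ m).eval (1 / 2)) * (y ^ 2 / 2) ^ m) := by
  have hz2 : 0 < (z / 2).re := by simpa using hz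
  have e := ascPochhammer_one_half m
  have hne : (m.factorial : ℂ) * (ascPochhammer ℂ m).eval (1 / 2) ≠ 0 := fun h0 => by
    rw [h0, zero_mul] at e
    exact (2 * m).factorial_ne_zero (by exact_mod_cast e.symm)
  have h42 : (4 : ℂ) ^ m = 2 ^ m * 2 ^ m := by rw [← mul_pow]; norm_num
  have h2 : (2 : ℂ) ^ m ≠ 0 := pow_ne_zero _ (by norm_num)
  have e1 : (z + ((2 * m : ℕ) : ℂ)) / 2 = z / 2 + m := by push_cast; ring
  rw [e1, Gamma_add_nat_eq_ascPochhammer hz2, ← e, show z / 2 + m - 1 = (z / 2 - 1) + m by ring,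
    Complex.cpow_add _ _ two_ne_zero, Complex.cpow_natCast, div_pow, pow_mul, neg_sq, h42]
  generalize (m.factorial : ℂ) * (ascPochhammer ℂ m).eval (1 / 2) = A at *
  generalize (2 : ℂ) ^ (z / 2 - 1) = B
  field_simp

theorem cylinderIntegral_odd_term {z : ℂ} (hz : 0 < z.re) (y : ℂ) (m : ℕ) :
    (-y) ^ (2 * m + 1) / (2 * m + 1).factorial * (2 ^ ((z + ((2 * m + 1 : ℕ) : ℂ)) / 2 - 1) *
      Complex.Gamma ((z + ((2 * m + 1 : ℕ) : ℂ)) / 2)) =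
    -y * (2 ^ ((z + 1) / 2 - 1) * Complex.Gamma ((z + 1) / 2)) *
      ((ascPochhammer ℂ m).eval ((z + 1) / 2) /
      (m.factorial * (ascPochhammer ℂ m).eval (3 / 2)) * (y ^ 2 / 2) ^ m) := by
  have hz2 : 0 < ((z + 1) / 2).re := by simp; linarith
  have e := ascPochhammer_three_halves m
  have hne : (m.factorial : ℂ) * (ascPochhammer ℂ m).eval (3 / 2) ≠ 0 := fun h0 => by
    rw [h0, zero_mul] at e
    exact (2 * m + 1).factorial_ne_zero (by exact_mod_cast e.symm)
  have h42 : (4 : ℂ) ^ m = 2 ^ m * 2 ^ m := by rw [← mul_pow]; norm_num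
  have h2 : (2 : ℂ) ^ m ≠ 0 := pow_ne_zero _ (by norm_num)
  have e1 : (z + ((2 * m + 1 : ℕ) : ℂ)) / 2 = (z + 1) / 2 + m := by push_cast; ring
  rw [e1, Gamma_add_nat_eq_ascPochhammer hz2, ← e,
    show (z + 1) / 2 + m - 1 = ((z + 1) / 2 - 1) + m by ring,
    Complex.cpow_add _ _ two_ne_zero, Complex.cpow_natCast, div_pow, pow_succ, pow_mul, neg_sq, h42]
  generalize (m.factorial : ℂ) * (ascPochhammer ℂ m).eval (3 / 2) = A at *
  generalize (2 : ℂ) ^ ((z + 1) / 2 - 1) = B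
  field_simp

theorem HasSum.eq_tsum_even_add_tsum_odd {f e o : ℕ → ℂ} {a : ℂ} (h : HasSum f a)
    (he : ∀ m, f (2 * m) = e m) (ho : ∀ m, f (2 * m + 1) = o m) :
    a = ∑' m, e m + ∑' m, o m := by
  have he' := h.summable.comp_injective (mul_right_injective₀ (two_ne_zero' ℕ))
  have ho' := h.summable.comp_injective ((add_left_injective 1).comp
      (mul_right_injective₀ (two_ne_zero' ℕ)))
  rw [← h.tsum_eq, ← tsum_even_add_odd he' ho']
  simp_rw [he, ho]

theorem cylinderIntegral_eq_kummerM {z : ℂ} (hz : 0 < z.re) (y : ℝ) :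
    cylinderIntegral z y =
      2 ^ (z / 2 - 1) * Complex.Gamma (z / 2) * kummerM (z / 2) (1 / 2) ((y : ℂ) ^ 2 / 2) +
      -y * (2 ^ ((z + 1) / 2 - 1) * Complex.Gamma ((z + 1) / 2)) *
        kummerM ((z + 1) / 2) (3 / 2) ((y : ℂ) ^ 2 / 2) := by
  rw [kummerM_eq_tsum _ _ (by norm_num), kummerM_eq_tsum _ _ (by norm_num), ← tsum_mul_left,
    ← tsum_mul_left]
  exact (hasSum_cylinderIntegral hz y).eq_tsum_even_add_tsum_odd
    (cylinderIntegral_even_term hz y) (cylinderIntegral_odd_term hz y)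

/-- Legendre's duplication formula turns `Γ(z) / Γ((z+1)/2)` and `Γ(z) / Γ(z/2)` into the
coefficients of the two Kummer functions in the integral. -/
theorem Gamma_mul_parabolicCylinderU {z : ℂ} (hz : 0 < z.re) (y : ℝ) :
    Complex.Gamma z * parabolicCylinderU (z - 1 / 2) y =
      Complex.exp (-(y : ℂ) ^ 2 / 4) * cylinderIntegral z y := by
  have hz2 : Complex.Gamma (z / 2) ≠ 0 :=
    Complex.Gamma_ne_zero_of_re_pos (by simpa using hz)
  have hz3 : Complex.Gamma ((z + 1) / 2) ≠ 0 :=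
    Complex.Gamma_ne_zero_of_re_pos (by simp; linarith)
  have hd := Complex.Gamma_mul_Gamma_add_half (z / 2)
  rw [show z / 2 + 1 / 2 = (z + 1) / 2 by ring, show 2 * (z / 2) = z by ring,
    Complex.cpow_sub _ _ two_ne_zero, Complex.cpow_one] at hd
  have hsq : ((Real.sqrt 2 : ℝ) : ℂ) = 2 ^ (1 / 2 : ℂ) := by
    rw [Real.sqrt_eq_rpow, Complex.ofReal_cpow zero_le_two]
    push_cast
    rfl
  have hsq2 : ((Real.sqrt 2 : ℝ) : ℂ) * ((Real.sqrt 2 : ℝ) : ℂ) = 2 := by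
    rw [← Complex.ofReal_mul, Real.mul_self_sqrt zero_le_two]
    simp
  have hp : (2 : ℂ) ^ (z / 2) ≠ 0 := by simp [Complex.cpow_eq_zero_iff]
  have hzz : (2 : ℂ) ^ z = 2 ^ (z / 2) * 2 ^ (z / 2) := by
    rw [← Complex.cpow_add _ _ two_ne_zero]
    ring_nf
  rw [cylinderIntegral_eq_kummerM hz, parabolicCylinderU, parabolicCylinderD,
    show -(z - 1 / 2) - 1 / 2 = -z by ring, neg_neg,
    show (1 - -z) / 2 = (z + 1) / 2 by ring, neg_div, Complex.cpow_neg,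
    show (z + 1) / 2 - 1 = z / 2 - 1 / 2 by ring, Complex.cpow_sub _ _ two_ne_zero,
    Complex.cpow_sub _ _ two_ne_zero, Complex.cpow_one, ← hsq]
  have hs0 : ((Real.sqrt 2 : ℝ) : ℂ) ≠ 0 := fun h0 => by simp [h0] at hsq2
  rw [hzz] at hd
  field_simp at hd ⊢
  rw [hd]
  linear_combination -(2 * Complex.Gamma z * (Real.sqrt Real.pi : ℂ) *
    Complex.Gamma ((z + 1) / 2) * y * kummerM ((z + 1) / 2) (3 / 2) ((y : ℂ) ^ 2 / 2)) * hsq2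

/-! ### The series as an integral over `w`. -/

/-- Sum and integral may be exchanged because the integrals of the norms are the terms of the
convergent series at `Re z`. -/
theorem tsum_hermitePsi_sq_div_eq_integral {z : ℂ} (hz : 0 < z.re) (x : ℝ) :
    ∑' n : ℕ, ((hermitePsi n x : ℝ) : ℂ) ^ 2 / ((n : ℂ) + z) =
      ∫ w in Set.Ioi (0 : ℝ), ((1 + w : ℝ) : ℂ) ^ (-z) *
        ((Real.exp (-x ^ 2 * (w / (2 + w))) /
          (Real.sqrt Real.pi * (Real.sqrt w * Real.sqrt (2 + w))) : ℝ) : ℂ) := by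
  have hre (n : ℕ) : 0 < ((n : ℂ) + z).re := by
    simp only [Complex.add_re, Complex.natCast_re]; positivity
  have hsum : Summable (fun n : ℕ => hermitePsi n x ^ 2 / (n + z.re)) :=
    summable_of_sum_range_le (fun n => by positivity)
      (by simpa using sum_hermitePsi_sq_div_le hz x 0)
  have h := hasSum_integral_of_summable_integral_norm
    (μ := (volume : Measure ℝ).restrict (Set.Ioi 0))
    (F := fun (n : ℕ) (w : ℝ) => ((hermitePsi n x : ℝ) : ℂ) ^ 2 *
      ((1 + w : ℝ) : ℂ) ^ (-((n : ℂ) + z) - 1))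
    (fun n => (integrableOn_one_add_cpow (hre n)).const_mul _) ?_
  · simp_rw [integral_const_mul, fun n => integral_one_add_cpow (hre n), mul_one_div] at h
    rw [h.tsum_eq]
    refine setIntegral_congr_fun measurableSet_Ioi fun w hw => ?_
    have hw0 : (0 : ℝ) < w := hw
    have hw1 : 0 < 1 + w := by linarith
    have hwc : ((1 + w : ℝ) : ℂ) ≠ 0 := by exact_mod_cast hw1.ne'
    have hm := hasSum_hermitePsi_sq (r := (1 + w)⁻¹) (by positivity)
      (inv_lt_one_of_one_lt₀ (by linarith)) x
    have hm' := (Complex.hasSum_ofReal.2 hm).mul_left (((1 + w : ℝ) : ℂ) ^ (-z - 1))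
    have hterm (n : ℕ) : ((hermitePsi n x : ℝ) : ℂ) ^ 2 *
        ((1 + w : ℝ) : ℂ) ^ (-((n : ℂ) + z) - 1) = ((1 + w : ℝ) : ℂ) ^ (-z - 1) *
          ((hermitePsi n x ^ 2 * (1 + w)⁻¹ ^ n : ℝ) : ℂ) := by
      rw [show -((n : ℂ) + z) - 1 = (-z - 1) + -n by ring, Complex.cpow_add _ _ hwc,
        Complex.cpow_neg, Complex.cpow_natCast]
      push_cast
      rw [inv_pow]
      ring
    simp_rw [hterm]
    rw [hm'.tsum_eq, Complex.cpow_sub _ _ hwc, Complex.cpow_one, div_mul_eq_mul_div,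
      mul_div_assoc, ← Complex.ofReal_div]
    congr 2
    have h1 : 1 - (1 + w)⁻¹ ^ 2 = w * (2 + w) / (1 + w) ^ 2 := by field_simp; ring
    have h2 : (1 - (1 + w)⁻¹) / (1 + (1 + w)⁻¹) = w / (2 + w) := by
      field_simp; ring
    rw [h1, h2, Real.sqrt_mul Real.pi_nonneg, Real.sqrt_div (by positivity), Real.sqrt_sq hw1.le,
      Real.sqrt_mul hw0.le]
    field_simp
  · refine hsum.congr fun n => ?_
    have hn : 0 < (n : ℝ) + z.re := by positivity
    rw [div_eq_mul_one_div, ← integral_one_add_rpow hn, ← integral_const_mul]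
    refine setIntegral_congr_fun measurableSet_Ioi fun w hw => ?_
    have hw0 : (0 : ℝ) < w := hw
    simp only [norm_mul, norm_pow, Complex.norm_real, Real.norm_eq_abs, sq_abs]
    rw [Complex.norm_cpow_eq_rpow_re_of_pos (by linarith)]
    simp

/-! ### The product of two cylinder integrals. -/

theorem integrable_exp_neg_mul_sq_add {b : ℝ} (hb : 0 < b) (c : ℝ) :
    Integrable (fun u : ℝ => Real.exp (-b * u ^ 2 + c * u)) := by
  have h := (integrable_cexp_quadratic (b := (b : ℂ)) (by simpa using hb) c 0).re
  refine h.congr (Filter.Eventually.of_forall fun u => ?_)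
  simp only [add_zero]
  rw [show (-(b : ℂ) * u ^ 2 + c * u) = ((-b * u ^ 2 + c * u : ℝ) : ℂ) by push_cast; ring,
    ← Complex.ofReal_exp]
  rfl

theorem integral_exp_neg_mul_sq_add {b : ℝ} (hb : 0 < b) (c : ℝ) :
    ∫ u : ℝ, Real.exp (-b * u ^ 2 + c * u) = Real.sqrt (Real.pi / b) *
      Real.exp (c ^ 2 / (4 * b)) := by
  have h := integral_cexp_quadratic (b := -(b : ℂ)) (by simpa using hb) c 0
  have h1 : (1 / 2 : ℂ) = ((1 / 2 : ℝ) : ℂ) := by norm_num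
  rw [neg_neg, ← Complex.ofReal_div, h1, ← Complex.ofReal_cpow (by positivity),
    ← Real.sqrt_eq_rpow] at h
  rw [← Complex.ofReal_inj, ← integral_complex_ofReal]
  simp only [add_zero, zero_sub, mul_neg, div_neg, neg_neg] at h
  push_cast
  exact h

theorem integral_inv_sqrt_mul_exp_neg {A : ℝ} (hA : 0 < A) :
    ∫ w in Set.Ioi (0 : ℝ), (Real.sqrt w)⁻¹ * Real.exp (-(A * w)) =
      Real.sqrt Real.pi / Real.sqrt A := by
  have h := Real.integral_rpow_mul_exp_neg_mul_Ioi (a := 1 / 2) (by norm_num) hA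
  rw [Real.Gamma_one_half_eq, ← Real.sqrt_eq_rpow, Real.sqrt_div zero_le_one, Real.sqrt_one] at h
  rw [div_eq_mul_one_div, mul_comm, ← h]
  refine setIntegral_congr_fun measurableSet_Ioi fun w hw => ?_
  have hw0 : (0 : ℝ) < w := hw
  rw [Real.sqrt_eq_rpow, ← Real.rpow_neg hw0.le]
  norm_num

theorem image_sub_div_Ioi {p : ℝ} (hp : 0 < p) :
    (fun s : ℝ => s - p / s) '' Set.Ioi 0 = Set.univ := by
  refine Set.eq_univ_of_forall fun u => ?_
  have h1 : Real.sqrt (u ^ 2 + 4 * p) ^ 2 = u ^ 2 + 4 * p := Real.sq_sqrt (by positivity)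
  have h2 : |u| < Real.sqrt (u ^ 2 + 4 * p) := by
    rw [← Real.sqrt_sq_eq_abs]
    exact Real.sqrt_lt_sqrt (sq_nonneg u) (by linarith)
  have h3 : 0 < u + Real.sqrt (u ^ 2 + 4 * p) := by linarith [neg_abs_le u]
  -- The positive root of `s² - us - p = 0`.
  refine ⟨(u + Real.sqrt (u ^ 2 + 4 * p)) / 2, half_pos h3, ?_⟩
  simp only
  field_simp
  linarith

/-- The substitution `u = s - p / s`. -/
theorem integral_div_sqrt_sq_add {p : ℝ} (hp : 0 < p) (g : ℝ → ℝ) :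
    ∫ u : ℝ, g u / Real.sqrt (u ^ 2 + 4 * p) =
      ∫ s in Set.Ioi (0 : ℝ), s⁻¹ * g (s - p / s) := by
  have hinj : Set.InjOn (fun s : ℝ => s - p / s) (Set.Ioi 0) := by
    intro s hs t ht hst
    have hs0 : 0 < s := hs
    have ht0 : 0 < t := ht
    have h : s - p / s = t - p / t := hst
    field_simp at h
    have h' : (s - t) * (s * t + p) = 0 := by linarith
    rcases mul_eq_zero.1 h' with h0 | h0
    · linarith
    · have := mul_pos hs0 ht0
      linarith
  have hd : ∀ s ∈ Set.Ioi (0 : ℝ), HasDerivWithinAt (fun s : ℝ => s - p / s) (1 + p / s ^ 2)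
      (Set.Ioi 0) s := by
    intro s hs
    have hs0 : s ≠ 0 := ne_of_gt hs
    have h1 := (hasDerivAt_inv hs0).const_mul p
    refine ((hasDerivAt_id s).sub h1).hasDerivWithinAt.congr_deriv ?_
    field_simp
    ring
  rw [← setIntegral_univ, ← image_sub_div_Ioi hp,
    integral_image_eq_integral_abs_deriv_smul measurableSet_Ioi hd hinj]
  refine setIntegral_congr_fun measurableSet_Ioi fun s hs => ?_
  have hs0 : (0 : ℝ) < s := hs
  -- The Jacobian `1 + p/s²` is `(s + p/s) / s`, so the square root cancels and only `1/s` survives.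
  have h1 : (s - p / s) ^ 2 + 4 * p = (s + p / s) ^ 2 := by field_simp; ring
  simp only [smul_eq_mul]
  rw [h1, Real.sqrt_sq (by positivity), abs_of_pos (by positivity)]
  field_simp

theorem integrable_inv_mul_mul_comp_inv_mul {f g : ℝ → ℂ} (hfm : Measurable f)
    (hgm : Measurable g) (hf : IntegrableOn f (Set.Ioi 0)) (hg : IntegrableOn g (Set.Ioi 0)) :
    Integrable (fun q : ℝ × ℝ => ((q.1⁻¹ : ℝ) : ℂ) * f q.1 * g (q.1⁻¹ * q.2))
      (((volume : Measure ℝ).restrict (Set.Ioi 0)).prod (volume.restrict (Set.Ioi 0))) := by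
  rw [integrable_prod_iff (Measurable.aestronglyMeasurable (by fun_prop))]
  constructor
  · refine (ae_restrict_iff' measurableSet_Ioi).2 (Filter.Eventually.of_forall fun s hs => ?_)
    have hs0 : (0 : ℝ) < s⁻¹ := inv_pos.2 hs
    have h : Integrable (fun p => g (s⁻¹ * p)) (volume.restrict (Set.Ioi 0)) :=
      (integrableOn_Ioi_comp_mul_left_iff g 0 hs0).2 (by simpa using hg)
    exact h.const_mul (((s⁻¹ : ℝ) : ℂ) * f s)
  · refine (hf.norm.mul_const (∫ t in Set.Ioi (0 : ℝ), ‖g t‖)).congr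
      ((ae_restrict_iff' measurableSet_Ioi).2 (Filter.Eventually.of_forall fun s hs => ?_))
    have hs0 : (0 : ℝ) < s := hs
    have h := integral_comp_mul_left_Ioi (fun t => ‖g t‖) 0 (inv_pos.2 hs0)
    simp only [norm_mul]
    rw [integral_const_mul, h]
    simp [abs_of_pos hs0]
    field_simp

/-- Multiplicative convolution: the change of variables `p = st` at fixed `s`, after Fubini. -/
theorem integral_integral_inv_mul_mul_comp_inv_mul {f g : ℝ → ℂ} (hfm : Measurable f)
    (hgm : Measurable g) (hf : IntegrableOn f (Set.Ioi 0)) (hg : IntegrableOn g (Set.Ioi 0)) :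
    ∫ p in Set.Ioi (0 : ℝ), ∫ s in Set.Ioi (0 : ℝ), ((s⁻¹ : ℝ) : ℂ) * f s * g (s⁻¹ * p) =
      (∫ s in Set.Ioi (0 : ℝ), f s) * ∫ t in Set.Ioi (0 : ℝ), g t := by
  rw [← integral_integral_swap (f := fun s p : ℝ => ((s⁻¹ : ℝ) : ℂ) * f s * g (s⁻¹ * p))
    (integrable_inv_mul_mul_comp_inv_mul hfm hgm hf hg), ← integral_mul_const]
  refine setIntegral_congr_fun measurableSet_Ioi fun s hs => ?_
  have hs0 : (0 : ℝ) < s := hs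
  have hsc : (s : ℂ) ≠ 0 := by exact_mod_cast hs0.ne'
  have h := integral_comp_mul_left_Ioi g 0 (inv_pos.2 hs0)
  rw [integral_const_mul, h]
  simp
  field_simp

theorem cylinderIntegral_mul_cylinderIntegral_neg {z : ℂ} (hz : 0 < z.re) (c : ℝ) :
    cylinderIntegral z c * cylinderIntegral z (-c) =
      ∫ p in Set.Ioi (0 : ℝ), ∫ u : ℝ, (p : ℂ) ^ (z - 1) *
        ((Real.exp (-p) * (Real.exp (-u ^ 2 / 2 + c * u) / Real.sqrt (u ^ 2 + 4 * p)) : ℝ) : ℂ) := by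
  -- The factor at `-c` is taken in the variable `s`, so that the linear exponent is `c(s - t) =
  -- cu`; moreover `s² + t² = u² + 2p`.
  rw [mul_comm, cylinderIntegral, cylinderIntegral, ← integral_integral_inv_mul_mul_comp_inv_mul
    (f := fun t : ℝ => (t : ℂ) ^ (z - 1) * Complex.exp (-(t : ℂ) ^ 2 / 2 - ((-c : ℝ) : ℂ) * t))
    (by fun_prop) (by fun_prop) (integrableOn_cylinderIntegrand hz (-c))
    (integrableOn_cylinderIntegrand hz c)]
  refine setIntegral_congr_fun measurableSet_Ioi fun p hp => ?_
  have hp0 : (0 : ℝ) < p := hp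
  rw [integral_const_mul, integral_complex_ofReal, integral_const_mul,
    integral_div_sqrt_sq_add hp0 (fun u => Real.exp (-u ^ 2 / 2 + c * u)), ← integral_const_mul,
    ← integral_complex_ofReal, ← integral_const_mul]
  refine setIntegral_congr_fun measurableSet_Ioi fun s hs => ?_
  have hs0 : (0 : ℝ) < s := hs
  have hsc : (s : ℂ) ≠ 0 := by exact_mod_cast hs0.ne'
  have h1 : (p : ℂ) ^ (z - 1) = (s : ℂ) ^ (z - 1) * ((s⁻¹ * p : ℝ) : ℂ) ^ (z - 1) := by
    rw [← Complex.mul_cpow_ofReal_nonneg hs0.le (by positivity), ← Complex.ofReal_mul,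
      mul_inv_cancel_left₀ hs0.ne']
  have h2 : Real.exp (-p) * (s⁻¹ * Real.exp (-(s - p / s) ^ 2 / 2 + c * (s - p / s))) =
      s⁻¹ * (Real.exp (-s ^ 2 / 2 + c * s) * Real.exp (-(s⁻¹ * p) ^ 2 / 2 - c * (s⁻¹ * p))) := by
    rw [mul_left_comm, ← Real.exp_add, ← Real.exp_add]
    congr 2
    field_simp
    ring
  rw [h1, h2]
  push_cast
  ring_nf

/-- The integrand linking the two sides through Laplace and Gaussian integrals. -/
noncomputable def cylinderKernel (z : ℂ) (c : ℝ) (w : ℝ) (q : ℝ × ℝ) : ℂ :=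
  (((Real.sqrt w)⁻¹ : ℝ) : ℂ) *
    (((q.1 : ℂ) ^ (z - 1) * Complex.exp (-(((1 + w : ℝ) : ℂ) * q.1))) *
      ((Real.exp (-((2 + w) / 4) * q.2 ^ 2 + c * q.2) : ℝ) : ℂ))

theorem integrableOn_cpow_mul_exp_neg_mul {z : ℂ} (hz : 0 < z.re) {r : ℝ} (hr : 0 < r) :
    IntegrableOn (fun p : ℝ => (p : ℂ) ^ (z - 1) * Complex.exp (-((r : ℂ) * p))) (Set.Ioi 0) := by
  have h := integrableOn_rpow_mul_exp_neg_mul_rpow (p := 1) (s := z.re - 1) (b := r)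
    (by linarith) one_pos hr
  refine h.mono' (Measurable.aestronglyMeasurable (by fun_prop))
    ((ae_restrict_iff' measurableSet_Ioi).2 (Filter.Eventually.of_forall fun p hp => ?_))
  have hp0 : (0 : ℝ) < p := hp
  rw [norm_mul, Complex.norm_cpow_eq_rpow_re_of_pos hp0, Complex.norm_exp]
  simp

theorem integral_norm_cpow_mul_exp_neg_mul {z : ℂ} (hz : 0 < z.re) {r : ℝ} (hr : 0 < r) :
    ∫ p in Set.Ioi (0 : ℝ), ‖(p : ℂ) ^ (z - 1) * Complex.exp (-((r : ℂ) * p))‖ =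
      (1 / r) ^ z.re * Real.Gamma z.re := by
  rw [← Real.integral_rpow_mul_exp_neg_mul_Ioi hz hr]
  refine setIntegral_congr_fun measurableSet_Ioi fun p hp => ?_
  have hp0 : (0 : ℝ) < p := hp
  rw [norm_mul, Complex.norm_cpow_eq_rpow_re_of_pos hp0, Complex.norm_exp]
  simp

/-- For fixed `w` the norm factors into a Gamma integral of size `(1 + w)^(-Re z)` and a Gaussian
one of size at most a constant times `(1 + w)^(-1/2)`; with `w^(-1/2)` this is the majorant of the
tail estimates. -/
theorem integrable_cylinderKernel {z : ℂ} (hz : 0 < z.re) (c : ℝ) :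
    Integrable (Function.uncurry (cylinderKernel z c))
      (((volume : Measure ℝ).restrict (Set.Ioi 0)).prod
        ((volume.restrict (Set.Ioi 0)).prod volume)) := by
  have hmeas : Measurable (Function.uncurry (cylinderKernel z c)) := by
    unfold cylinderKernel
    fun_prop
  rw [integrable_prod_iff hmeas.aestronglyMeasurable]
  constructor
  · refine (ae_restrict_iff' measurableSet_Ioi).2 (Filter.Eventually.of_forall fun w hw => ?_)
    have hw0 : (0 : ℝ) < w := hw
    have hE : Integrable (fun u : ℝ => ((Real.exp (-((2 + w) / 4) * u ^ 2 + c * u) : ℝ) : ℂ)) :=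
      (integrable_exp_neg_mul_sq_add (b := (2 + w) / 4) (by positivity) c).ofReal
    have hp := integrableOn_cpow_mul_exp_neg_mul hz (r := 1 + w) (by linarith)
    simp only [Function.uncurry_apply_pair, cylinderKernel]
    exact (Integrable.mul_prod hp hE).const_mul _
  · refine ((integrableOn_rpow_mul_one_add_rpow hz).const_mul
      (Real.Gamma z.re * (Real.sqrt (4 * Real.pi) * Real.exp (c ^ 2)))).mono'
      hmeas.aestronglyMeasurable.norm.integral_prod_right'
      ((ae_restrict_iff' measurableSet_Ioi).2 (Filter.Eventually.of_forall fun w hw => ?_))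
    have hw0 : (0 : ℝ) < w := hw
    have hw1 : 0 < 1 + w := by linarith
    have hG := Real.Gamma_pos_of_pos hz
    rw [Real.norm_of_nonneg (integral_nonneg fun _ => norm_nonneg _)]
    simp only [Function.uncurry_apply_pair, cylinderKernel]
    simp_rw [norm_mul _ (_ * _ : ℂ), norm_mul (_ * _ : ℂ) (Complex.ofReal _)]
    rw [integral_const_mul, integral_prod_mul
      (fun p : ℝ => ‖(p : ℂ) ^ (z - 1) * Complex.exp (-(((1 + w : ℝ) : ℂ) * p))‖)
      (fun u : ℝ => ‖((Real.exp (-((2 + w) / 4) * u ^ 2 + c * u) : ℝ) : ℂ)‖),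
      integral_norm_cpow_mul_exp_neg_mul hz hw1]
    simp_rw [Complex.norm_real, Real.norm_of_nonneg (Real.exp_nonneg _),
      Real.norm_of_nonneg (inv_nonneg.2 (Real.sqrt_nonneg w))]
    rw [integral_exp_neg_mul_sq_add (by positivity)]
    have h1 : Real.sqrt (Real.pi / ((2 + w) / 4)) ≤
        Real.sqrt (4 * Real.pi) * (1 + w) ^ (-(1 / 2) : ℝ) := by
      rw [Real.rpow_neg hw1.le, ← Real.sqrt_eq_rpow, ← Real.sqrt_inv,
        ← Real.sqrt_mul (by positivity)]
      refine Real.sqrt_le_sqrt ?_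
      rw [← div_eq_mul_inv, div_div_eq_mul_div, mul_comm]
      gcongr
      norm_num
    have h2 : Real.exp (c ^ 2 / (4 * ((2 + w) / 4))) ≤ Real.exp (c ^ 2) :=
      Real.exp_le_exp.2 (div_le_self (sq_nonneg c) (by linarith))
    have h3 : (Real.sqrt w)⁻¹ = w ^ (-(1 / 2) : ℝ) := by
      rw [Real.rpow_neg hw0.le, Real.sqrt_eq_rpow]
    have h4 : (1 / (1 + w)) ^ z.re = (1 + w) ^ (-z.re) := by
      rw [one_div, Real.inv_rpow hw1.le, Real.rpow_neg hw1.le]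
    rw [h3, h4, show -z.re - 1 / 2 = -z.re + -(1 / 2) by ring, Real.rpow_add hw1]
    calc _ ≤ w ^ (-(1 / 2) : ℝ) * ((1 + w) ^ (-z.re) * Real.Gamma z.re *
          (Real.sqrt (4 * Real.pi) * (1 + w) ^ (-(1 / 2) : ℝ) * Real.exp (c ^ 2))) := by
          gcongr
      _ = _ := by ring

theorem integral_cylinderKernel_right {z : ℂ} (hz : 0 < z.re) (c : ℝ) {w : ℝ} (hw : 0 < w) :
    ∫ q, cylinderKernel z c w q ∂(((volume : Measure ℝ).restrict (Set.Ioi 0)).prod volume) =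
      2 * (Real.sqrt Real.pi : ℂ) * Complex.Gamma z * (((1 + w : ℝ) : ℂ) ^ (-z) *
        ((Real.exp (c ^ 2 / (2 + w)) / (Real.sqrt w * Real.sqrt (2 + w)) : ℝ) : ℂ)) := by
  have hw1 : 0 < 1 + w := by linarith
  unfold cylinderKernel
  rw [integral_const_mul, integral_prod_mul
    (fun p : ℝ => (p : ℂ) ^ (z - 1) * Complex.exp (-(((1 + w : ℝ) : ℂ) * p)))
    (fun u : ℝ => ((Real.exp (-((2 + w) / 4) * u ^ 2 + c * u) : ℝ) : ℂ)),
    Complex.integral_cpow_mul_exp_neg_mul_Ioi hz hw1, integral_complex_ofReal,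
    integral_exp_neg_mul_sq_add (by positivity), one_div, Complex.inv_cpow, Complex.cpow_neg]
  · have h1 : Real.sqrt (Real.pi / ((2 + w) / 4)) =
        2 * Real.sqrt Real.pi / Real.sqrt (2 + w) := by
      rw [div_div_eq_mul_div, Real.sqrt_div (by positivity), Real.sqrt_mul Real.pi_nonneg,
        show (4 : ℝ) = 2 ^ 2 by norm_num, Real.sqrt_sq zero_le_two, mul_comm]
    rw [h1, show 4 * ((2 + w) / 4) = 2 + w by ring]
    push_cast
    ring
  · rw [Complex.arg_ofReal_of_nonneg hw1.le]
    exact Real.pi_ne_zero.symm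

/-- As a function of `w` the kernel is a multiple of `w^(-1/2) e^(-(p + u²/4)w)`, whose integral
supplies `1 / √(u² + 4p)`. -/
theorem integral_cylinderKernel_left (z : ℂ) (c : ℝ) {p : ℝ} (hp : 0 < p) (u : ℝ) :
    ∫ w in Set.Ioi (0 : ℝ), cylinderKernel z c w (p, u) =
      2 * (Real.sqrt Real.pi : ℂ) * ((p : ℂ) ^ (z - 1) *
        ((Real.exp (-p) * (Real.exp (-u ^ 2 / 2 + c * u) / Real.sqrt (u ^ 2 + 4 * p)) : ℝ) : ℂ)) := by
  have hA : 0 < p + u ^ 2 / 4 := by positivity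
  have h (w : ℝ) : cylinderKernel z c w (p, u) = (p : ℂ) ^ (z - 1) *
      ((Real.exp (-p) * Real.exp (-u ^ 2 / 2 + c * u) *
        ((Real.sqrt w)⁻¹ * Real.exp (-((p + u ^ 2 / 4) * w))) : ℝ) : ℂ) := by
    have e : Real.exp (-p) * Real.exp (-u ^ 2 / 2 + c * u) *
        ((Real.sqrt w)⁻¹ * Real.exp (-((p + u ^ 2 / 4) * w))) = (Real.sqrt w)⁻¹ *
        (Real.exp (-((1 + w) * p)) * Real.exp (-((2 + w) / 4) * u ^ 2 + c * u)) := by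
      rw [mul_left_comm, ← Real.exp_add, ← Real.exp_add, ← Real.exp_add]
      ring_nf
    rw [e, cylinderKernel]
    push_cast
    ring
  have h4 : Real.sqrt (u ^ 2 + 4 * p) = 2 * Real.sqrt (p + u ^ 2 / 4) := by
    rw [show u ^ 2 + 4 * p = 2 ^ 2 * (p + u ^ 2 / 4) by ring, Real.sqrt_mul (by positivity),
      Real.sqrt_sq zero_le_two]
  simp_rw [h]
  rw [integral_const_mul, integral_complex_ofReal, integral_const_mul,
    integral_inv_sqrt_mul_exp_neg hA, h4]
  have : (Real.sqrt (p + u ^ 2 / 4) : ℂ) ≠ 0 := by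
    exact_mod_cast (Real.sqrt_pos.2 hA).ne'
  push_cast
  field_simp

theorem cylinderIntegral_mul_cylinderIntegral_neg_eq {z : ℂ} (hz : 0 < z.re) (c : ℝ) :
    cylinderIntegral z c * cylinderIntegral z (-c) =
      Complex.Gamma z * ∫ w in Set.Ioi (0 : ℝ), ((1 + w : ℝ) : ℂ) ^ (-z) *
        ((Real.exp (c ^ 2 / (2 + w)) / (Real.sqrt w * Real.sqrt (2 + w)) : ℝ) : ℂ) := by
  have hI := integrable_cylinderKernel hz c
  have hpi : (2 * (Real.sqrt Real.pi : ℂ)) ≠ 0 := by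
    refine mul_ne_zero two_ne_zero ?_
    exact_mod_cast (Real.sqrt_pos.2 Real.pi_pos).ne'
  have hswap := integral_integral_swap hI
  have hiter := integral_prod _ hI.integral_prod_right
  simp only [Function.uncurry_apply_pair] at hiter
  rw [hiter] at hswap
  have hl : ∫ w in Set.Ioi (0 : ℝ), ∫ q, cylinderKernel z c w q
      ∂(((volume : Measure ℝ).restrict (Set.Ioi 0)).prod volume) =
      2 * (Real.sqrt Real.pi : ℂ) * Complex.Gamma z *
        ∫ w in Set.Ioi (0 : ℝ), ((1 + w : ℝ) : ℂ) ^ (-z) *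
        ((Real.exp (c ^ 2 / (2 + w)) / (Real.sqrt w * Real.sqrt (2 + w)) : ℝ) : ℂ) := by
    rw [← integral_const_mul]
    exact setIntegral_congr_fun measurableSet_Ioi fun w hw =>
      integral_cylinderKernel_right hz c hw
  have hr : ∫ p in Set.Ioi (0 : ℝ), ∫ u : ℝ, ∫ w in Set.Ioi (0 : ℝ), cylinderKernel z c w (p, u) =
      2 * (Real.sqrt Real.pi : ℂ) * (cylinderIntegral z c * cylinderIntegral z (-c)) := by
    rw [cylinderIntegral_mul_cylinderIntegral_neg hz, ← integral_const_mul]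
    refine setIntegral_congr_fun measurableSet_Ioi fun p hp => ?_
    rw [← integral_const_mul]
    exact integral_congr_ae (Filter.Eventually.of_forall fun u =>
      integral_cylinderKernel_left z c hp u)
  refine mul_left_cancel₀ hpi ?_
  rw [← hr, ← mul_assoc _ (Complex.Gamma z), ← hl, hswap]

/-! ### Comparison of the two integrals and conclusion. -/

theorem Gamma_mul_parabolicCylinderU_mul_neg {z : ℂ} (hz : 0 < z.re) (x : ℝ) :
    Complex.Gamma z * parabolicCylinderU (z - 1 / 2) ((x * Real.sqrt 2 : ℝ) : ℂ) *
        parabolicCylinderU (z - 1 / 2) ((-x * Real.sqrt 2 : ℝ) : ℂ) =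
      (Real.sqrt Real.pi : ℂ) *
        ∑' n : ℕ, ((hermitePsi n x : ℝ) : ℂ) ^ 2 / ((n : ℂ) + z) := by
  have hG : Complex.Gamma z ≠ 0 := Complex.Gamma_ne_zero_of_re_pos hz
  have h1 := Gamma_mul_parabolicCylinderU hz (x * Real.sqrt 2)
  have h2 := Gamma_mul_parabolicCylinderU hz (-x * Real.sqrt 2)
  have h3 := cylinderIntegral_mul_cylinderIntegral_neg_eq hz (x * Real.sqrt 2)
  have hc : (x * Real.sqrt 2) ^ 2 = 2 * x ^ 2 := by
    rw [mul_pow, Real.sq_sqrt zero_le_two, mul_comm]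
  have hc' : (-x * Real.sqrt 2) ^ 2 = 2 * x ^ 2 := by rw [neg_mul, neg_sq, hc]
  have h4 : (Real.sqrt Real.pi : ℂ) *
      ∑' n : ℕ, ((hermitePsi n x : ℝ) : ℂ) ^ 2 / ((n : ℂ) + z) =
      ((Real.exp (-x ^ 2) : ℝ) : ℂ) * ∫ w in Set.Ioi (0 : ℝ), ((1 + w : ℝ) : ℂ) ^ (-z) *
        ((Real.exp ((x * Real.sqrt 2) ^ 2 / (2 + w)) /
          (Real.sqrt w * Real.sqrt (2 + w)) : ℝ) : ℂ) := by
    rw [tsum_hermitePsi_sq_div_eq_integral hz, ← integral_const_mul, ← integral_const_mul]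
    refine setIntegral_congr_fun measurableSet_Ioi fun w hw => ?_
    have hw0 : (0 : ℝ) < w := hw
    -- The integrands match because `w / (2 + w) = 1 - 2 / (2 + w)`.
    have e : Real.exp (-x ^ 2 * (w / (2 + w))) =
        Real.exp (-x ^ 2) * Real.exp ((x * Real.sqrt 2) ^ 2 / (2 + w)) := by
      rw [hc, ← Real.exp_add]
      congr 1
      field_simp
      ring
    have hpi : (Real.sqrt Real.pi : ℂ) ≠ 0 := by
      exact_mod_cast (Real.sqrt_pos.2 Real.pi_pos).ne'
    rw [e]
    push_cast
    field_simp
  have h5 : Complex.exp (-((x * Real.sqrt 2 : ℝ) : ℂ) ^ 2 / 4) *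
      Complex.exp (-((-x * Real.sqrt 2 : ℝ) : ℂ) ^ 2 / 4) = ((Real.exp (-x ^ 2) : ℝ) : ℂ) := by
    rw [← Complex.exp_add, ← Complex.ofReal_pow, ← Complex.ofReal_pow, hc, hc']
    push_cast
    ring_nf
  -- A second factor `Γ(z)` gives each cylinder function its own.
  refine mul_left_cancel₀ hG ?_
  rw [h4, ← h5]
  rw [neg_mul] at h2 ⊢
  generalize (∫ w in Set.Ioi (0 : ℝ), ((1 + w : ℝ) : ℂ) ^ (-z) *
        ((Real.exp ((x * Real.sqrt 2) ^ 2 / (2 + w)) /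
          (Real.sqrt w * Real.sqrt (2 + w)) : ℝ) : ℂ)) = J at *
  calc _ = (Complex.Gamma z * parabolicCylinderU (z - 1 / 2) ((x * Real.sqrt 2 : ℝ) : ℂ)) *
        (Complex.Gamma z * parabolicCylinderU (z - 1 / 2) ((-(x * Real.sqrt 2) : ℝ) : ℂ)) := by
        ring
    _ = _ := by
      rw [h1, h2]
      linear_combination Complex.exp (-((x * Real.sqrt 2 : ℝ) : ℂ) ^ 2 / 4) *
        Complex.exp (-((-(x * Real.sqrt 2) : ℝ) : ℂ) ^ 2 / 4) * h3

theorem mainTheorem2 (z : ℂ) (hz : 0 < z.re) :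
    (∀ x : ℝ, Summable (fun n : ℕ => ‖((hermitePsi n x : ℝ) : ℂ) ^ 2 / ((n : ℂ) + z)‖)) ∧
    TendstoUniformly
      (fun (N : ℕ) (x : ℝ) =>
        ∑ n ∈ Finset.range N, ‖((hermitePsi n x : ℝ) : ℂ) ^ 2 / ((n : ℂ) + z)‖)
      (fun x : ℝ => ∑' n : ℕ, ‖((hermitePsi n x : ℝ) : ℂ) ^ 2 / ((n : ℂ) + z)‖)
      Filter.atTop ∧
    TendstoUniformly
      (fun (N : ℕ) (x : ℝ) =>
        ∑ n ∈ Finset.range N, ((hermitePsi n x : ℝ) : ℂ) ^ 2 / ((n : ℂ) + z))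
      (fun x : ℝ => ∑' n : ℕ, ((hermitePsi n x : ℝ) : ℂ) ^ 2 / ((n : ℂ) + z))
      Filter.atTop ∧
    ∀ x : ℝ,
      Complex.Gamma z *
          parabolicCylinderU (z - 1 / 2) ((x * Real.sqrt 2 : ℝ) : ℂ) *
          parabolicCylinderU (z - 1 / 2) ((-x * Real.sqrt 2 : ℝ) : ℂ) =
        (Real.sqrt Real.pi : ℂ) *
          ∑' n : ℕ, ((hermitePsi n x : ℝ) : ℂ) ^ 2 / ((n : ℂ) + z) := by
  refine ⟨fun x => ?_, ?_, ?_, Gamma_mul_parabolicCylinderU_mul_neg hz⟩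
  · exact summable_norm_of_tail_le fun N M => sum_norm_hermitePsi_sq_div_le hz N M x
  · exact tendstoUniformly_sum_of_tail_le (tendsto_hermiteTailBound hz) fun N M x => by
      simpa only [norm_norm] using sum_norm_hermitePsi_sq_div_le hz N M x
  · exact tendstoUniformly_sum_of_tail_le (tendsto_hermiteTailBound hz) fun N M x =>
      sum_norm_hermitePsi_sq_div_le hz N M x
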